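/- **Setting.** Let $\chi$ be a finite set of decisions with $|\chi|\ge 2$, let $Y\subset\mathbb R^d$ ($d\ge 1$) be a bounded set of contexts with interior $Y^\circ$, and let $P_Y$ be a Borel probability measure carried by $Y$. For $x\in\chi$ let $f_x:Y\to\mathbb R$ be uniformly bounded and Lipschitz, and let $\sigma_x:Y\to(0,\infty)$ be Lipschitz. Let $x^*(y)\in\arg\min_{x} f_x(y)$, and let $MO$ be the set of contexts $y\in Y$ for which the minimizer is not unique. *Data.* At each stage $t=1,2,\dots$ a pair $(x_{[t]},y_{[t]})$ is sampled from a density $a^{(t)}(x,y)$ on $\chi\times Y^\circ$ (with respect to counting measure times Lebesgue measure), which may depend on the past data $\mathcal D^{(t-1)}$; then $\tilde G_{[t]}=f_{x_{[t]}}(y_{[t]})+\epsilon_{[t]}$ is observed, where, given the past and $(x_{[t]},y_{[t]})=(x,y)$, the error $\epsilon_{[t]}$ is normal with mean $0$ and standard deviation $\sigma_x(y)$. Assume that for some $\lambda_L>0$ we have $a^{(t)}(x,y)>\lambda_L$ for all $t$, all $x\in\chi$ and all $y\in Y^\circ$. *Estimator.* Fix $c,\xi>0$ and put $r_m=c\,m^{-\xi/d}$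 for $m\ge 1$. For $y\in Y^\circ$ let $b_m^{(t)}(x,y)$ be the set of observations $i\le t$ with $x_{[i]}=x$, $y_{[i]}\in Y^\circ$ and $\|y_{[i]}-y\|<r_m$. Let $\Psi=\Psi^{(t)}_{x,y}$ be the largest $m\ge1$ with $|b_m^{(t)}(x,y)|\ge m$, let $\tau\le t$ be the first stage at which $|b_\Psi^{(\tau)}(x,y)|=\Psi$, and let $\hat f^{(t)}_x(y)$ be the average of the $\Psi$ outputs $\tilde G_{[i]}$ in $b_\Psi^{(\tau)}(x,y)$ (and $0$ if no such $m$ exists). Let $\hat x^{(t)}(y)$ be a minimizer of $x\mapsto\hat f_x^{(t)}(y)$, with ties broken in any (possibly random) way. *Loss.* Let $\rho$ be a Borel measurable metric on $\mathbb R$ that is bounded on bounded sets, such as $\rho(u,v)=|u-v|$ or $\rho(u,v)=\mathbf 1_{u\ne v}$. Let $$\upsilon^{(t)}(y)=E\,\rho\big(f_{\hat x^{(t)}(y)}(y),f_{x^*(y)}(y)\big),\qquad \varpi^{(t)}_{Y_{sub}}=\int_{Y_{sub}}\upsilon^{(t)}(y)\,dP_Y(y).$$ *Rate.* Let $C=\frac{\pi^{d/2}}{\Gamma(d/2+1)}c^d$,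 let $W_{-1}$ be the lower branch of the Lambert function (for $z\in[-e^{-1},0)$, $w=W_{-1}(z)$ is the solution $w\le-1$ of $we^w=z$), and for $y\in Y^\circ\setminus MO$ let $$\zeta(y)=\min_{x\ne x^*(y)}\frac{(f_x(y)-f_{x^*(y)}(y))^2}{2(\sigma_{x^*(y)}(y)^2+\sigma_x(y)^2)},\qquad H_y=(C\lambda_L)^{\frac1{1+\xi}}\,\zeta(y)\,\big(-W_{-1}(-e^{-\zeta(y)-1})\big)^{-\frac1{1+\xi}}.$$ **Proposition.** For every compact $Y_{sub}\subset Y^\circ$ with $Y_{sub}\cap MO=\emptyset$, with $H_{Y_{sub}}:=\inf_{y\in Y_{sub}}H_y$, $$\liminf_{t\to\infty}-\frac{1}{t^{1/(1+\xi)}}\ln\varpi^{(t)}_{Y_{sub}}\;\ge\;H_{Y_{sub}}\;>\;0$$ (where $\ln 0=-\infty$ and $\inf\emptyset=+\infty$). In particular, for every real $c_2<H_{Y_{sub}}$ we have $\varpi^{(t)}_{Y_{sub}}\le\exp(-c_2t^{1/(1+\xi)})$ for all large $t$. -/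

import Mathlib

open MeasureTheory ProbabilityTheory Filter Topology
open scoped ENNReal NNReal

/-- `d`-dimensional Euclidean space, in which the contexts live. -/
abbrev Ctx (d : ℕ) := EuclideanSpace ℝ (Fin d)

/-! ### Optimal decisions and the rate constants -/

section Optimum

variable {χ : Type*} {d : ℕ}

/-- `x` is a conditional optimal decision for the performance values `g`: it minimizes `g`. -/
def IsOptimal (g : χ → ℝ) (x : χ) : Prop := ∀ x', g x ≤ g x'

/-- The multi-optimum contexts: contexts in `Y` with at least two optimal decisions. -/
def multiOptimum (Y : Set (Ctx d)) (f : χ → Ctx d → ℝ) : Set (Ctx d) :=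
  {y | y ∈ Y ∧ ∃ x₁ x₂, x₁ ≠ x₂ ∧
    IsOptimal (fun x => f x y) x₁ ∧ IsOptimal (fun x => f x y) x₂}

theorem exists_isOptimal [Finite χ] [Nonempty χ] (g : χ → ℝ) : ∃ x, IsOptimal g x :=
  Finite.exists_min g

/-- `x*(y)`: the optimal decision in context `y` (an optimal one if it is not unique). -/
noncomputable def xStar [Finite χ] [Nonempty χ] (f : χ → Ctx d → ℝ) (y : Ctx d) : χ :=
  (exists_isOptimal fun x => f x y).choose

/-- The lower branch `W₋₁` of the Lambert function: for `-1/e ≤ z < 0`, the unique `w ≤ -1`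
with `w * exp w = z` (and `0` for other `z`, where no such `w` exists). -/
noncomputable def lambertWm1 (z : ℝ) : ℝ :=
  open Classical in if h : ∃ w : ℝ, w ≤ -1 ∧ w * Real.exp w = z then h.choose else 0

/-- `ζ(y)`, the minimum over `x ≠ x*(y)` of
`(f_x(y) - f_{x*}(y))² / (2 (σ_{x*}(y)² + σ_x(y)²))`. -/
noncomputable def zeta [Finite χ] [Nonempty χ] (f σ : χ → Ctx d → ℝ) (y : Ctx d) : ℝ :=
  ⨅ x : {x : χ // x ≠ xStar f y},
    (f x y - f (xStar f y) y) ^ 2 / (2 * (σ (xStar f y) y ^ 2 + σ x y ^ 2))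

/-- `C = π^(d/2) / Γ(d/2 + 1) * c^d`. -/
noncomputable def volConst (d : ℕ) (c : ℝ) : ℝ :=
  Real.pi ^ ((d : ℝ) / 2) / Real.Gamma ((d : ℝ) / 2 + 1) * c ^ d

/-- `H_y = (C λ_L)^(1/(1+ξ)) ζ(y) (-W₋₁(-exp(-ζ(y) - 1)))^(-1/(1+ξ))`. -/
noncomputable def rateH [Finite χ] [Nonempty χ] (c ξ lamL : ℝ) (f σ : χ → Ctx d → ℝ)
    (y : Ctx d) : ℝ :=
  (volConst d c * lamL) ^ (1 / (1 + ξ)) * zeta f σ y *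
    (-lambertWm1 (-Real.exp (-zeta f σ y - 1))) ^ (-(1 / (1 + ξ)))

/-- `H_{Y_sub}`, the infimum of `H_y` over `y ∈ Y_sub`, in the extended reals. -/
noncomputable def rateHSub [Finite χ] [Nonempty χ] (c ξ lamL : ℝ) (f σ : χ → Ctx d → ℝ)
    (Ysub : Set (Ctx d)) : EReal :=
  ⨅ y ∈ Ysub, (rateH c ξ lamL f σ y : EReal)

end Optimum

/-! ### Shrinking neighborhood estimation from a data sequence

The data are sequences `xs`, `ys`, `gs` of decisions, contexts and outputs, numbered from `0`;
the data set at stage `t` consists of the observations with index `i < t`. -/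

section SNE

variable {χ : Type*} {d : ℕ}

/-- The radius `r_m = c m^(-ξ/d)`. -/
noncomputable def radius (d : ℕ) (c ξ : ℝ) (m : ℕ) : ℝ := c * (m : ℝ) ^ (-ξ / d)

/-- The `m`-set `b_m^{(t)}(x, y)`, as the finite set of indices of its observations. -/
noncomputable def mSet (Y : Set (Ctx d)) (c ξ : ℝ) (xs : ℕ → χ) (ys : ℕ → Ctx d)
    (x : χ) (y : Ctx d) (t m : ℕ) : Finset ℕ :=
  open Classical in (Finset.range t).filter fun i =>
    xs i = x ∧ ‖ys i - y‖ < radius d c ξ m ∧ ys i ∈ interior Y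

/-- `Ψ^{(t)}_{x,y}`: the largest `m` whose `m`-set is activated at stage `t`, that is, contains at
least `m` observations (such an `m` is at most `t`); it is `0` if there is no such `m ≥ 1`. -/
noncomputable def psiLevel (Y : Set (Ctx d)) (c ξ : ℝ) (xs : ℕ → χ) (ys : ℕ → Ctx d)
    (x : χ) (y : Ctx d) (t : ℕ) : ℕ :=
  Nat.findGreatest (fun m => m ≤ (mSet Y c ξ xs ys x y t m).card) t

/-- The stage at which the `m`-set became activated: the first stage at which it had exactly
`m` elements. -/
noncomputable def activationStage (Y : Set (Ctx d)) (c ξ : ℝ) (xs : ℕ → χ) (ys : ℕ → Ctx d)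
    (x : χ) (y : Ctx d) (t m : ℕ) : ℕ :=
  sInf {t' | t' ≤ t ∧ (mSet Y c ξ xs ys x y t' m).card = m}

/-- The neighborhood sample set `b_{x,y}^{(t)}`: the `Ψ`-set frozen at the stage at which it was
activated. Activation stages increase with `m` because the `m`-sets are nested, so this is the last
stage up to `t` at which some `m`-set was newly activated. -/
noncomputable def neighborhood (Y : Set (Ctx d)) (c ξ : ℝ) (xs : ℕ → χ) (ys : ℕ → Ctx d)
    (x : χ) (y : Ctx d) (t : ℕ) : Finset ℕ :=
  mSet Y c ξ xs ys x y
    (activationStage Y c ξ xs ys x y t (psiLevel Y c ξ xs ys x y t))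
    (psiLevel Y c ξ xs ys x y t)

/-- The shrinking neighborhood estimator `f̂_x^{(t)}(y)`: the average of the outputs over the
neighborhood sample set (it is `0` as long as no `m`-set is activated). -/
noncomputable def sne (Y : Set (Ctx d)) (c ξ : ℝ) (xs : ℕ → χ) (ys : ℕ → Ctx d) (gs : ℕ → ℝ)
    (t : ℕ) (x : χ) (y : Ctx d) : ℝ :=
  1 / (psiLevel Y c ξ xs ys x y t : ℝ) * ∑ i ∈ neighborhood Y c ξ xs ys x y t, gs i

end SNE

/-! ### Data generation -/

section Sampling

variable {χ : Type*} {d : ℕ} {Ω : Type*} [mΩ : MeasurableSpace Ω] [MeasurableSpace χ]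

/-- A sequential random sampling run. The `t`-th observation has decision `X t`, context `Yc t` and
random error `ε t`; `𝓕 t` is the information available after `t` observations (for instance the
σ-algebra generated by these observations), on which the choice of the next sampling density may
depend.

* `sampling`: conditionally on `𝓕 t`, the pair `(X t, Yc t)` has the density `a t` with respect to
  (counting measure on `χ`) × (Lebesgue measure on the interior of `Y`). That `a t` integrates to
  one is a consequence (`A` and `V` the whole space).
* `noise`: runs are independent, that is, conditionally on `𝓕 t` and on `(X t, Yc t) = (x, y)`,
  the error `ε t` is normal with mean `0` and standard deviation `σ x y`. -/
structure IsSamplingRun (Y : Set (Ctx d)) (σ : χ → Ctx d → ℝ) (μ : Measure Ω)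
    (𝓕 : Filtration ℕ mΩ) (X : ℕ → Ω → χ) (Yc : ℕ → Ω → Ctx d) (ε : ℕ → Ω → ℝ)
    (a : ℕ → Ω → χ → Ctx d → ℝ) : Prop where
  measurable_decision : ∀ t, Measurable[𝓕 (t + 1)] (X t)
  measurable_context : ∀ t, Measurable[𝓕 (t + 1)] (Yc t)
  measurable_error : ∀ t, Measurable[𝓕 (t + 1)] (ε t)
  measurable_density : ∀ t x,
    Measurable[(𝓕 t).prod inferInstance] fun p : Ω × Ctx d => a t p.1 x p.2
  sampling : ∀ t (A : Set Ω), MeasurableSet[𝓕 t] A → ∀ x (V : Set (Ctx d)), MeasurableSet V →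
    μ (A ∩ {ω | X t ω = x ∧ Yc t ω ∈ V}) =
      ∫⁻ ω in A, ∫⁻ y in V ∩ interior Y, ENNReal.ofReal (a t ω x y) ∂volume ∂μ
  noise : ∀ t (A : Set Ω), MeasurableSet[𝓕 t] A → ∀ x (V : Set (Ctx d)), MeasurableSet V →
    ∀ S : Set ℝ, MeasurableSet S →
    μ (A ∩ {ω | X t ω = x ∧ Yc t ω ∈ V} ∩ {ω | ε t ω ∈ S}) =
      ∫⁻ ω in A ∩ {ω | X t ω = x ∧ Yc t ω ∈ V},
        gaussianReal 0 (σ x (Yc t ω) ^ 2).toNNReal S ∂μ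

/-- The estimate `f̂_x^{(t)}(y)` computed from the random data set, whose outputs are
`f_{x_i}(y_i) + ε_i`. -/
noncomputable def estimate (Y : Set (Ctx d)) (c ξ : ℝ) (f : χ → Ctx d → ℝ) (X : ℕ → Ω → χ)
    (Yc : ℕ → Ω → Ctx d) (ε : ℕ → Ω → ℝ) (t : ℕ) (x : χ) (y : Ctx d) (ω : Ω) : ℝ :=
  sne Y c ξ (fun i => X i ω) (fun i => Yc i ω) (fun i => f (X i ω) (Yc i ω) + ε i ω) t x y

end Sampling

/-! ### Decision loss -/

/-- `ρ` is a metric on the real line. -/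
structure IsRealMetric (ρ : ℝ → ℝ → ℝ) : Prop where
  eq_zero_iff : ∀ u v, ρ u v = 0 ↔ u = v
  symm : ∀ u v, ρ u v = ρ v u
  triangle : ∀ u v w, ρ u w ≤ ρ u v + ρ v w

section Loss

variable {χ : Type*} {d : ℕ} {Ω : Type*} [MeasurableSpace Ω] [Finite χ] [Nonempty χ]

/-- The expected decision loss `υ^{(t)}(y) = E ρ(f_{x̂^{(t)}(y)}(y), f_{x*(y)}(y))`, where
`xhat t y` is the inferred decision. It is an integral of a nonnegative function. -/
noncomputable def condLoss (μ : Measure Ω) (f : χ → Ctx d → ℝ) (ρ : ℝ → ℝ → ℝ)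
    (xhat : ℕ → Ctx d → Ω → χ) (t : ℕ) (y : Ctx d) : ℝ≥0∞ :=
  ∫⁻ ω, ENNReal.ofReal (ρ (f (xhat t y ω) y) (f (xStar f y) y)) ∂μ

/-- The total decision loss restricted to `Ysub`, i.e. the integral of `υ^{(t)}` over `Ysub`. -/
noncomputable def subLoss (μ : Measure Ω) (PY : Measure (Ctx d)) (f : χ → Ctx d → ℝ)
    (ρ : ℝ → ℝ → ℝ) (xhat : ℕ → Ctx d → Ω → χ) (Ysub : Set (Ctx d)) (t : ℕ) : ℝ≥0∞ :=
  ∫⁻ y in Ysub, condLoss μ f ρ xhat t y ∂PY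

end Loss

/-!
A wrong decision in context `y` at stage `t` needs one of two rare events. Write `p = 1 / (1 + ξ)`,
`K = C λ_L`, and let `m = ⌈α t ^ p⌉`.

*The `m`-set of some decision is not activated.* If the ball of radius `r_m` around `y` lies in the
interior of `Y`, each observation hits the `m`-set with conditional probability at least
`K m ^ (-ξ)`, whatever the past. Chernoff's bound (`IsSamplingRun.measure_hitCount_lt_le`) makes the
event at most `exp (-m (u - 1 - log u))` to first order, where `u = K α ^ (-(1 + ξ))` is the
limiting ratio of the expected number of hits to `m`.

*The estimates are misordered although both levels are at least `m`.* The sampling densities may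
depend on past errors, so the errors in a neighborhood sample set are not independent given the
design. But whether an observation enters the `m`-set before its activation is decided before its
error is drawn, and the set frozen at activation consists exactly of these observations
(`mSet_activationStage`). For fixed levels `m₁, m₂ ≥ m` the normalized exponential of a linear
combination of the two error sums is therefore a supermartingale, and Markov's inequality gives the
Gaussian bound `exp (-m (ζ(y) - o(1)))` (`IsSamplingRun.measure_average_error_le`). A union bound
over the at most `(t + 1) ^ 2` pairs of levels costs only a polynomial factor.

The two exponents agree when `u - 1 - log u = ζ`, which is the equation of the Lambert function
(`lambertWm1_spec`) for `u = -W₋₁(-exp (-ζ - 1))`; the common value `α ζ` is then `H`. To make this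
uniform on `Ysub`, `α` is chosen for a context `y₀` of minimal `ζ` (`exists_zeta_le`): both
exponents are then at least `H_{y₀}` for all `y` in `Ysub`. Since `H` is a monotone function of
`ζ` (`rate_mono`), `H_{y₀}` is the infimum of `H` over `Ysub`.
-/

/-! ### Exponential moments under a filtration -/

/-- If the conditional expectation of `g` given `m` is at most `r`, expressed by integrals over
`m`-measurable sets, then a nonnegative `m`-measurable weight can be taken out. -/
theorem lintegral_mul_le_of_forall_setLIntegral_le {Ω : Type*} {m mΩ : MeasurableSpace Ω}
    (hm : m ≤ mΩ) {μ : Measure Ω} {g W : Ω → ℝ≥0∞} {r : ℝ≥0∞} (hg : Measurable g)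
    (h : ∀ A, MeasurableSet[m] A → ∫⁻ ω in A, g ω ∂μ ≤ r * μ A) (hW : Measurable[m] W) :
    ∫⁻ ω, W ω * g ω ∂μ ≤ r * ∫⁻ ω, W ω ∂μ := by
  have hle : (μ.withDensity g).trim hm ≤ r • μ.trim hm := by
    refine Measure.le_iff.2 fun A hA => ?_
    rw [trim_measurableSet_eq hm hA, withDensity_apply _ (hm A hA), Measure.smul_apply,
      trim_measurableSet_eq hm hA, smul_eq_mul]
    exact h A hA
  calc ∫⁻ ω, W ω * g ω ∂μ = ∫⁻ ω, W ω ∂(μ.withDensity g) := by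
        rw [lintegral_withDensity_eq_lintegral_mul _ hg (hW.mono hm le_rfl)]
        simp [mul_comm]
    _ = ∫⁻ ω, W ω ∂((μ.withDensity g).trim hm) := (lintegral_trim hm hW).symm
    _ ≤ ∫⁻ ω, W ω ∂(r • μ.trim hm) := lintegral_mono' hle le_rfl
    _ = r * ∫⁻ ω, W ω ∂μ := by rw [lintegral_smul_measure, lintegral_trim hm hW, smul_eq_mul]

/-- A product of adapted nonnegative factors, each with conditional mean at most `r` given the past,
has mean at most `r ^ k`. This covers both Chernoff's bound for the number of hits and the
exponential supermartingale of the errors (`r = 1`). -/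
theorem lintegral_prod_le_pow {Ω : Type*} {mΩ : MeasurableSpace Ω} {μ : Measure Ω}
    (𝓕 : Filtration ℕ mΩ) {G : ℕ → Ω → ℝ≥0∞} {r : ℝ≥0∞}
    (hG : ∀ i, Measurable[𝓕 (i + 1)] (G i))
    (h : ∀ i A, MeasurableSet[𝓕 i] A → ∫⁻ ω in A, G i ω ∂μ ≤ r * μ A) (k : ℕ) :
    ∫⁻ ω, ∏ i ∈ Finset.range k, G i ω ∂μ ≤ r ^ k * μ Set.univ := by
  induction k with
  | zero => simp
  | succ k ih =>
    have hW : Measurable[𝓕 k] fun ω => ∏ i ∈ Finset.range k, G i ω :=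
      Finset.measurable_fun_prod _ fun i hi =>
        (hG i).mono (𝓕.mono (Finset.mem_range.1 hi)) le_rfl
    simp only [Finset.prod_range_succ]
    refine (lintegral_mul_le_of_forall_setLIntegral_le (𝓕.le k)
      ((hG k).mono (𝓕.le _) le_rfl) (h k) hW).trans ?_
    rw [pow_succ', mul_assoc]
    gcongr

theorem lintegral_exp_gaussianReal_le_one (s w : ℝ) (v : ℝ≥0) (hv : v ≤ w) :
    ∫⁻ x, ENNReal.ofReal (Real.exp (s * x - s ^ 2 * w / 2)) ∂gaussianReal 0 v ≤ 1 := by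
  have hint := (integrable_exp_mul_gaussianReal (μ := 0) (v := v) s).mul_const
    (Real.exp (-(s ^ 2 * w / 2)))
  have hmgf := congrFun (mgf_id_gaussianReal (μ := 0) (v := v)) s
  simp only [mgf, id, zero_mul, zero_add] at hmgf
  simp only [sub_eq_add_neg, Real.exp_add]
  rw [← ofReal_integral_eq_lintegral_ofReal hint (ae_of_all _ fun x => by positivity),
    integral_mul_const, hmgf, ← Real.exp_add, ← ENNReal.ofReal_one]
  refine ENNReal.ofReal_le_ofReal (Real.exp_le_one_iff.2 ?_)
  nlinarith [mul_le_mul_of_nonneg_left hv (sq_nonneg s)]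

/-- If, on the event `E`, the variable `e` is a mixture of centered normal laws with variances
`τ ω ^ 2 ≤ w`, its normalized exponential has integral at most `μ E` over `E`. The deviation `τ`
needs to be measurable on `E` only. -/
theorem setLIntegral_exp_gaussian_le {Ω : Type*} {mΩ : MeasurableSpace Ω} {μ : Measure Ω}
    {E : Set Ω} (hE : MeasurableSet E) {τ e : Ω → ℝ}
    (hτ : Measurable (E.indicator τ)) (he : Measurable e)
    (hlaw : ∀ S, MeasurableSet S → μ (E ∩ {ω | e ω ∈ S}) =
      ∫⁻ ω in E, gaussianReal 0 (τ ω ^ 2).toNNReal S ∂μ)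
    (s w : ℝ) (hw : ∀ ω ∈ E, τ ω ^ 2 ≤ w) :
    ∫⁻ ω in E, ENNReal.ofReal (Real.exp (s * e ω - s ^ 2 * w / 2)) ∂μ ≤ μ E := by
  set κ : Ω → Measure ℝ := fun ω => gaussianReal 0 (E.indicator τ ω ^ 2).toNNReal with hκ
  have hκm : Measurable κ :=
    measurable_gaussianReal.comp (measurable_const.prodMk (hτ.pow_const 2).real_toNNReal)
  have hmap : (μ.restrict E).map e = (μ.restrict E).bind κ := by
    ext S hS
    rw [Measure.map_apply he hS, Measure.restrict_apply (he hS), Measure.bind_apply hS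
      hκm.aemeasurable, Set.inter_comm]
    refine (hlaw S hS).trans (setLIntegral_congr_fun hE fun ω hω => ?_)
    simp [hκ, hω]
  have hg : Measurable fun x : ℝ => ENNReal.ofReal (Real.exp (s * x - s ^ 2 * w / 2)) := by
    fun_prop
  calc ∫⁻ ω in E, ENNReal.ofReal (Real.exp (s * e ω - s ^ 2 * w / 2)) ∂μ
      = ∫⁻ x, ENNReal.ofReal (Real.exp (s * x - s ^ 2 * w / 2)) ∂((μ.restrict E).map e) :=
        (lintegral_map hg he).symm
    _ = ∫⁻ ω in E, ∫⁻ x, ENNReal.ofReal (Real.exp (s * x - s ^ 2 * w / 2)) ∂κ ω ∂μ := by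
        rw [hmap, Measure.lintegral_bind hκm.aemeasurable hg.aemeasurable]
    _ ≤ ∫⁻ ω in E, 1 ∂μ := by
        refine setLIntegral_mono' hE fun ω hω => lintegral_exp_gaussianReal_le_one _ _ _ ?_
        rw [Set.indicator_of_mem hω, Real.coe_toNNReal _ (sq_nonneg _)]
        exact hw ω hω
    _ = μ E := by simp

/-! ### The sample set frozen at activation -/

section Frozen

variable {χ : Type*} {d : ℕ} {Y : Set (Ctx d)} {c ξ : ℝ} {xs : ℕ → χ} {ys : ℕ → Ctx d}
  {x : χ} {y : Ctx d} {t m i : ℕ}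

theorem mem_mSet : i ∈ mSet Y c ξ xs ys x y t m ↔
    i < t ∧ xs i = x ∧ ‖ys i - y‖ < radius d c ξ m ∧ ys i ∈ interior Y := by
  simp [mSet]

theorem mSet_mono {t t' : ℕ} (h : t ≤ t') :
    mSet Y c ξ xs ys x y t m ⊆ mSet Y c ξ xs ys x y t' m := fun i hi => by
  rw [mem_mSet] at hi ⊢
  exact ⟨hi.1.trans_le h, hi.2⟩

theorem card_mSet_le : (mSet Y c ξ xs ys x y t m).card ≤ t := by
  simpa using Finset.card_le_card
    (fun i hi => Finset.mem_range.2 (mem_mSet.1 hi).1 : mSet Y c ξ xs ys x y t m ⊆ Finset.range t)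

theorem card_mSet_succ_le :
    (mSet Y c ξ xs ys x y (t + 1) m).card ≤ (mSet Y c ξ xs ys x y t m).card + 1 := by
  classical
  refine (Finset.card_le_card (t := insert t (mSet Y c ξ xs ys x y t m)) fun i hi => ?_).trans
    (Finset.card_insert_le _ _)
  rw [Finset.mem_insert, mem_mSet]
  rw [mem_mSet] at hi
  rcases hi with ⟨h1, h2⟩
  rcases Nat.lt_succ_iff_lt_or_eq.1 h1 with h | h
  · exact Or.inr ⟨h, h2⟩
  · exact Or.inl h

/-- The cardinality of the `m`-set grows in steps of at most one, so it takes the value `m`. -/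
theorem exists_card_mSet_eq (h : m ≤ (mSet Y c ξ xs ys x y t m).card) :
    ∃ t' ≤ t, (mSet Y c ξ xs ys x y t' m).card = m := by
  induction t with
  | zero => exact ⟨0, le_rfl, le_antisymm (card_mSet_le.trans (Nat.zero_le m)) h⟩
  | succ t ih =>
    by_cases h' : m ≤ (mSet Y c ξ xs ys x y t m).card
    · obtain ⟨t', ht', e⟩ := ih h'
      exact ⟨t', ht'.trans t.le_succ, e⟩
    · have := card_mSet_succ_le (Y := Y) (c := c) (ξ := ξ) (xs := xs) (ys := ys) (x := x)
        (y := y) (t := t) (m := m)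
      exact ⟨t + 1, le_rfl, by omega⟩

/-- The observations that entered the `m`-set while it had fewer than `m` elements. Whether
observation `i` belongs to this set is decided by the first `i` observations and the decision
and context of observation `i`, but not by its error. -/
noncomputable def frozenSet (Y : Set (Ctx d)) (c ξ : ℝ) (xs : ℕ → χ) (ys : ℕ → Ctx d)
    (x : χ) (y : Ctx d) (t m : ℕ) : Finset ℕ :=
  (mSet Y c ξ xs ys x y t m).filter fun i => (mSet Y c ξ xs ys x y i m).card < m

theorem mem_frozenSet : i ∈ frozenSet Y c ξ xs ys x y t m ↔
    i < t ∧ (mSet Y c ξ xs ys x y i m).card < m ∧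
      xs i = x ∧ ‖ys i - y‖ < radius d c ξ m ∧ ys i ∈ interior Y := by
  rw [frozenSet, Finset.mem_filter, mem_mSet]
  tauto

/-- The `m`-set at its activation stage consists of the observations that entered it while it had
fewer than `m` elements. This turns the stopping time into a condition on each observation. -/
theorem mSet_activationStage (h : m ≤ (mSet Y c ξ xs ys x y t m).card) :
    mSet Y c ξ xs ys x y (activationStage Y c ξ xs ys x y t m) m =
      frozenSet Y c ξ xs ys x y t m ∧ (frozenSet Y c ξ xs ys x y t m).card = m := by
  set τ := activationStage Y c ξ xs ys x y t m with hτ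
  have hne : {t' | t' ≤ t ∧ (mSet Y c ξ xs ys x y t' m).card = m}.Nonempty :=
    exists_card_mSet_eq h
  obtain ⟨hτt, hτm⟩ : τ ≤ t ∧ (mSet Y c ξ xs ys x y τ m).card = m := Nat.sInf_mem hne
  have key : mSet Y c ξ xs ys x y τ m = frozenSet Y c ξ xs ys x y t m := by
    ext i
    rw [mem_frozenSet, mem_mSet]
    constructor
    · rintro ⟨hi, hr⟩
      refine ⟨hi.trans_le hτt, lt_of_le_of_ne
        ((Finset.card_le_card (mSet_mono hi.le)).trans hτm.le) fun he => ?_, hr⟩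
      exact absurd (Nat.sInf_le (⟨(hi.trans_le hτt).le, he⟩ :
        i ∈ {t' | t' ≤ t ∧ (mSet Y c ξ xs ys x y t' m).card = m})) (not_le.2 hi)
    · rintro ⟨-, hlt, hr⟩
      refine ⟨not_le.1 fun hle => ?_, hr⟩
      have := Finset.card_le_card (mSet_mono (Y := Y) (c := c) (ξ := ξ) (xs := xs) (ys := ys)
        (x := x) (y := y) (m := m) hle)
      omega
  exact ⟨key, key ▸ hτm⟩

theorem psiLevel_le_card : psiLevel Y c ξ xs ys x y t ≤
    (mSet Y c ξ xs ys x y t (psiLevel Y c ξ xs ys x y t)).card :=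
  Nat.findGreatest_spec (P := fun m => m ≤ (mSet Y c ξ xs ys x y t m).card) (Nat.zero_le t)
    (Nat.zero_le _)

theorem psiLevel_le : psiLevel Y c ξ xs ys x y t ≤ t := Nat.findGreatest_le t

theorem le_psiLevel (h : m ≤ (mSet Y c ξ xs ys x y t m).card) :
    m ≤ psiLevel Y c ξ xs ys x y t :=
  Nat.le_findGreatest (h.trans card_mSet_le) h

theorem sne_eq (gs : ℕ → ℝ) : sne Y c ξ xs ys gs t x y =
    (∑ i ∈ frozenSet Y c ξ xs ys x y t (psiLevel Y c ξ xs ys x y t), gs i) /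
      psiLevel Y c ξ xs ys x y t := by
  rw [sne, neighborhood, (mSet_activationStage psiLevel_le_card).1, one_div, inv_mul_eq_div]

theorem radius_anti (hc : 0 < c) (hξ : 0 < ξ) {m m' : ℕ} (hm : 1 ≤ m) (h : m ≤ m') :
    radius d c ξ m' ≤ radius d c ξ m := by
  refine mul_le_mul_of_nonneg_left ?_ hc.le
  refine Real.rpow_le_rpow_of_nonpos (by exact_mod_cast hm) (by exact_mod_cast h) ?_
  exact div_nonpos_of_nonpos_of_nonneg (by linarith) (Nat.cast_nonneg d)

/-- An average of outputs over a frozen set is the performance at `y` plus the average error, up to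
the variation of the performance over the neighborhood. -/
theorem sum_frozenSet_bounds (hm : 1 ≤ m) {F : χ → Ctx d → ℝ} {L₁ : ℝ≥0}
    (hF : LipschitzOnWith L₁ (F x) Y) (hy : y ∈ Y) {r : ℝ} (hr : radius d c ξ m ≤ r)
    (e : ℕ → ℝ) (h : m ≤ (mSet Y c ξ xs ys x y t m).card) :
    |(∑ i ∈ frozenSet Y c ξ xs ys x y t m, (F (xs i) (ys i) + e i)) / m -
      (F x y + (∑ i ∈ frozenSet Y c ξ xs ys x y t m, e i) / m)| ≤ L₁ * r := by
  have hm0 : (0 : ℝ) < m := by exact_mod_cast hm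
  have hcard := (mSet_activationStage h).2
  have : (∑ i ∈ frozenSet Y c ξ xs ys x y t m, (F (xs i) (ys i) + e i)) / m -
      (F x y + (∑ i ∈ frozenSet Y c ξ xs ys x y t m, e i) / m) =
      (∑ i ∈ frozenSet Y c ξ xs ys x y t m, (F (xs i) (ys i) - F x y)) / m := by
    rw [Finset.sum_add_distrib, Finset.sum_sub_distrib, Finset.sum_const, hcard, nsmul_eq_mul]
    field_simp
    ring
  rw [this, abs_div, abs_of_pos hm0, div_le_iff₀ hm0]
  refine (Finset.abs_sum_le_sum_abs _ _).trans ?_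
  refine (Finset.sum_le_card_nsmul _ _ (L₁ * r) fun i hi => ?_).trans ?_
  · obtain ⟨-, -, hx, hn, hi⟩ := mem_frozenSet.1 hi
    have := hF.dist_le_mul _ (interior_subset hi) _ hy
    rw [Real.dist_eq, dist_eq_norm] at this
    rw [hx]
    exact this.trans (mul_le_mul_of_nonneg_left (hn.le.trans hr) L₁.2)
  · rw [hcard, nsmul_eq_mul, mul_comm]

end Frozen

/-! ### Tail bounds for a sampling run -/

section Sampling

variable {χ : Type*} {d : ℕ} {Y : Set (Ctx d)} {c ξ : ℝ} {Ω : Type*} {X : ℕ → Ω → χ}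
  {Yc : ℕ → Ω → Ctx d}

/-- The event that observation `i` has decision `x` and a context in `V`. -/
def hitEvent (X : ℕ → Ω → χ) (Yc : ℕ → Ω → Ctx d) (x : χ) (V : Set (Ctx d)) (i : ℕ) : Set Ω :=
  {ω | X i ω = x ∧ Yc i ω ∈ V}

/-- The contexts that count for the `m`-set of `y`: those of the interior of `Y` at distance
less than `r_m` from `y`. -/
def contextBall (Y : Set (Ctx d)) (c ξ : ℝ) (y : Ctx d) (m : ℕ) : Set (Ctx d) :=
  {z | ‖z - y‖ < radius d c ξ m ∧ z ∈ interior Y}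

theorem measurableSet_contextBall {y : Ctx d} {m : ℕ} :
    MeasurableSet (contextBall Y c ξ y m) :=
  ((isOpen_lt (continuous_id.sub continuous_const).norm continuous_const).inter
    isOpen_interior).measurableSet

/-- The random cardinality of the `m`-set at stage `t`. -/
noncomputable def hitCount (Y : Set (Ctx d)) (c ξ : ℝ) (X : ℕ → Ω → χ) (Yc : ℕ → Ω → Ctx d)
    (x : χ) (y : Ctx d) (m t : ℕ) (ω : Ω) : ℕ :=
  (mSet Y c ξ (fun i => X i ω) (fun i => Yc i ω) x y t m).card

/-- The random set of the observations that entered the `m`-set before it was activated. -/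
noncomputable def frozen (Y : Set (Ctx d)) (c ξ : ℝ) (X : ℕ → Ω → χ) (Yc : ℕ → Ω → Ctx d)
    (x : χ) (y : Ctx d) (m t : ℕ) (ω : Ω) : Finset ℕ :=
  frozenSet Y c ξ (fun i => X i ω) (fun i => Yc i ω) x y t m

/-- The event that observation `i` enters the `m`-set before activation. -/
def acceptEvent (Y : Set (Ctx d)) (c ξ : ℝ) (X : ℕ → Ω → χ) (Yc : ℕ → Ω → Ctx d)
    (x : χ) (y : Ctx d) (m i : ℕ) : Set Ω :=
  {ω | hitCount Y c ξ X Yc x y m i ω < m} ∩ hitEvent X Yc x (contextBall Y c ξ y m) i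

theorem mem_frozen {x : χ} {y : Ctx d} {m t i : ℕ} {ω : Ω} :
    i ∈ frozen Y c ξ X Yc x y m t ω ↔ i < t ∧ ω ∈ acceptEvent Y c ξ X Yc x y m i :=
  mem_frozenSet

theorem hitCount_eq_sum (x : χ) (y : Ctx d) (m t : ℕ) (ω : Ω) :
    hitCount Y c ξ X Yc x y m t ω =
      ∑ i ∈ Finset.range t, (hitEvent X Yc x (contextBall Y c ξ y m) i).indicator 1 ω := by
  classical
  rw [hitCount, mSet, Finset.card_filter]
  refine Finset.sum_congr rfl fun i _ => ?_
  simp only [Set.indicator, hitEvent, contextBall, Set.mem_ofPred_eq, Pi.one_apply]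
  congr

variable [MeasurableSpace χ] {σ : χ → Ctx d → ℝ} [mΩ : MeasurableSpace Ω] {μ : Measure Ω}
  {𝓕 : Filtration ℕ mΩ} {ε : ℕ → Ω → ℝ} {a : ℕ → Ω → χ → Ctx d → ℝ}

/-- If the density is at least `lamL`, the chance of a hit is at least `lamL` times the volume,
whatever happened before. -/
theorem IsSamplingRun.le_measure_hitEvent (hrun : IsSamplingRun Y σ μ 𝓕 X Yc ε a) {lamL : ℝ}
    (ha : ∀ t ω x, ∀ y ∈ interior Y, lamL < a t ω x y) (x : χ)
    {V : Set (Ctx d)} (hV : MeasurableSet V) (hVY : V ⊆ interior Y) (i : ℕ) {A : Set Ω}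
    (hA : MeasurableSet[𝓕 i] A) :
    ENNReal.ofReal lamL * volume V * μ A ≤ μ (A ∩ hitEvent X Yc x V i) := by
  rw [hitEvent, hrun.sampling i A hA x V hV, Set.inter_eq_self_of_subset_left hVY,
    ← setLIntegral_const]
  refine setLIntegral_mono' (𝓕.le i A hA) fun ω _ => ?_
  rw [← setLIntegral_const]
  exact setLIntegral_mono' hV fun z hz => ENNReal.ofReal_le_ofReal (ha i ω x z (hVY hz)).le

variable [MeasurableSingletonClass χ]

theorem IsSamplingRun.measurableSet_hitEvent (hrun : IsSamplingRun Y σ μ 𝓕 X Yc ε a) (x : χ)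
    {V : Set (Ctx d)} (hV : MeasurableSet V) (i : ℕ) :
    MeasurableSet[𝓕 (i + 1)] (hitEvent X Yc x V i) :=
  MeasurableSet.inter (hrun.measurable_decision i (measurableSet_singleton x))
    (hrun.measurable_context i hV)

theorem IsSamplingRun.measurable_hitCount (hrun : IsSamplingRun Y σ μ 𝓕 X Yc ε a) (x : χ)
    (y : Ctx d) (m t : ℕ) : Measurable[𝓕 t] (hitCount Y c ξ X Yc x y m t) := by
  rw [show hitCount Y c ξ X Yc x y m t = _ from funext (hitCount_eq_sum x y m t)]
  refine Finset.measurable_fun_sum _ fun i hi => Measurable.indicator measurable_const ?_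
  exact 𝓕.mono (Finset.mem_range.1 hi) _
    (hrun.measurableSet_hitEvent x measurableSet_contextBall i)

theorem IsSamplingRun.measurableSet_acceptEvent (hrun : IsSamplingRun Y σ μ 𝓕 X Yc ε a) (x : χ)
    (y : Ctx d) (m i : ℕ) : MeasurableSet[𝓕 (i + 1)] (acceptEvent Y c ξ X Yc x y m i) :=
  MeasurableSet.inter
    (𝓕.mono i.le_succ _ (hrun.measurable_hitCount x y m i (measurableSet_Iio (a := m))))
    (hrun.measurableSet_hitEvent x measurableSet_contextBall i)

/-- One step of the exponential supermartingale for the errors: on the event that observation `i`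
is accepted, an event decided before the error is drawn, the normalized exponential of the
error has conditional mean at most `1`. -/
theorem IsSamplingRun.setLIntegral_exp_error_le (hrun : IsSamplingRun Y σ μ 𝓕 X Yc ε a)
    {x : χ} (hσ : ContinuousOn (σ x) (interior Y)) {y : Ctx d} {m : ℕ} {v : ℝ}
    (hv : ∀ z ∈ contextBall Y c ξ y m, σ x z ^ 2 ≤ v) (s : ℝ) (i : ℕ) {A : Set Ω}
    (hA : MeasurableSet[𝓕 i] A) :
    ∫⁻ ω in A ∩ acceptEvent Y c ξ X Yc x y m i,
      ENNReal.ofReal (Real.exp (s * ε i ω - s ^ 2 * v / 2)) ∂μ ≤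
      μ (A ∩ acceptEvent Y c ξ X Yc x y m i) := by
  classical
  have hB : MeasurableSet[𝓕 i] (A ∩ {ω | hitCount Y c ξ X Yc x y m i ω < m}) :=
    MeasurableSet.inter hA (hrun.measurable_hitCount x y m i (measurableSet_Iio (a := m)))
  have hE := hrun.measurableSet_hitEvent x
    (measurableSet_contextBall (Y := Y) (c := c) (ξ := ξ) (y := y) (m := m)) i
  rw [acceptEvent, ← Set.inter_assoc]
  have hEm := (𝓕.le i _ hB).inter (𝓕.le (i + 1) _ hE)
  have hσm : Measurable ((interior Y).indicator (σ x)) := by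
    rw [← Set.piecewise_eq_indicator]
    exact hσ.measurable_piecewise continuousOn_const isOpen_interior.measurableSet
  refine setLIntegral_exp_gaussian_le (τ := fun ω => σ x (Yc i ω)) hEm ?_
    ((hrun.measurable_error i).mono (𝓕.le _) le_rfl)
    (fun S hS => hrun.noise i _ hB x _ measurableSet_contextBall S hS) s v
    fun ω hω => hv _ hω.2.2
  convert (hσm.comp ((hrun.measurable_context i).mono (𝓕.le _) le_rfl)).indicator hEm using 1
  refine Set.indicator_congr fun ω hω => ?_
  exact (Set.indicator_of_mem hω.2.2.2 _).symm

/-- Markov's inequality for the exponential supermartingale built from the errors of two different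
decisions, at fixed levels `m₁` and `m₂`. -/
theorem IsSamplingRun.measure_error_le [IsProbabilityMeasure μ]
    (hrun : IsSamplingRun Y σ μ 𝓕 X Yc ε a) (hσ : ∀ x, ContinuousOn (σ x) (interior Y))
    {x₁ x₂ : χ} (hx : x₁ ≠ x₂) {y : Ctx d} {m₁ m₂ : ℕ} {v₁ v₂ : ℝ}
    (hv₁ : ∀ z ∈ contextBall Y c ξ y m₁, σ x₁ z ^ 2 ≤ v₁)
    (hv₂ : ∀ z ∈ contextBall Y c ξ y m₂, σ x₂ z ^ 2 ≤ v₂) (s₁ s₂ K : ℝ) (t : ℕ) :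
    μ {ω | m₁ ≤ hitCount Y c ξ X Yc x₁ y m₁ t ω ∧ m₂ ≤ hitCount Y c ξ X Yc x₂ y m₂ t ω ∧
      K ≤ s₁ * ∑ i ∈ frozen Y c ξ X Yc x₁ y m₁ t ω, ε i ω +
        s₂ * ∑ i ∈ frozen Y c ξ X Yc x₂ y m₂ t ω, ε i ω} ≤
      ENNReal.ofReal (Real.exp ((s₁ ^ 2 * (m₁ * v₁) + s₂ ^ 2 * (m₂ * v₂)) / 2 - K)) := by
  set E₁ := acceptEvent Y c ξ X Yc x₁ y m₁ with hE₁
  set E₂ := acceptEvent Y c ξ X Yc x₂ y m₂ with hE₂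
  set g₁ : ℕ → Ω → ℝ := fun i ω => s₁ * ε i ω - s₁ ^ 2 * v₁ / 2 with hg₁
  set g₂ : ℕ → Ω → ℝ := fun i ω => s₂ * ε i ω - s₂ ^ 2 * v₂ / 2 with hg₂
  set G : ℕ → Ω → ℝ≥0∞ := fun i ω =>
    ENNReal.ofReal (Real.exp ((E₁ i).indicator (g₁ i) ω + (E₂ i).indicator (g₂ i) ω)) with hG
  have hdisj : ∀ i, Disjoint (E₁ i) (E₂ i) := fun i =>
    Set.disjoint_left.2 fun ω h₁ h₂ => hx (h₁.2.1.symm.trans h₂.2.1)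
  have hm₁ := fun i => hrun.measurableSet_acceptEvent (c := c) (ξ := ξ) x₁ y m₁ i
  have hm₂ := fun i => hrun.measurableSet_acceptEvent (c := c) (ξ := ξ) x₂ y m₂ i
  have hGm : ∀ i, Measurable[𝓕 (i + 1)] (G i) := fun i => by
    have he := hrun.measurable_error i
    have h₁ : Measurable[𝓕 (i + 1)] ((E₁ i).indicator (g₁ i)) :=
      Measurable.indicator ((he.const_mul s₁).sub_const _) (hm₁ i)
    have h₂ : Measurable[𝓕 (i + 1)] ((E₂ i).indicator (g₂ i)) :=
      Measurable.indicator ((he.const_mul s₂).sub_const _) (hm₂ i)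
    exact (Real.measurable_exp.comp (h₁.add h₂)).ennreal_ofReal
  have hstep : ∀ i A, MeasurableSet[𝓕 i] A → ∫⁻ ω in A, G i ω ∂μ ≤ 1 * μ A := by
    intro i A hA
    have hA' := 𝓕.le i A hA
    have hE₁' : MeasurableSet (E₁ i) := 𝓕.le _ _ (hm₁ i)
    have hE₂' : MeasurableSet (E₂ i) := 𝓕.le _ _ (hm₂ i)
    have b₁ : ∫⁻ ω in A ∩ E₁ i, G i ω ∂μ ≤ μ (A ∩ E₁ i) := by
      refine le_trans (le_of_eq (setLIntegral_congr_fun (hA'.inter hE₁') fun ω hω => ?_))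
        (hrun.setLIntegral_exp_error_le (hσ x₁) hv₁ s₁ i hA)
      simp only [hG]
      rw [Set.indicator_of_mem hω.2,
        Set.indicator_of_notMem (Set.disjoint_left.1 (hdisj i) hω.2), add_zero]
    have b₂ : ∫⁻ ω in A \ E₁ i, G i ω ∂μ ≤ μ (A \ E₁ i) := by
      rw [← lintegral_inter_add_sdiff (G i) (A \ E₁ i) hE₂',
        ← measure_inter_add_sdiff (A \ E₁ i) hE₂']
      have e : (A \ E₁ i) ∩ E₂ i = A ∩ E₂ i := by
        ext ω
        exact ⟨fun h => ⟨h.1.1, h.2⟩,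
          fun h => ⟨⟨h.1, fun h₁ => Set.disjoint_left.1 (hdisj i) h₁ h.2⟩, h.2⟩⟩
      rw [e]
      refine add_le_add ?_ ?_
      · refine le_trans (le_of_eq (setLIntegral_congr_fun (hA'.inter hE₂') fun ω hω => ?_))
          (hrun.setLIntegral_exp_error_le (hσ x₂) hv₂ s₂ i hA)
        simp only [hG]
        rw [Set.indicator_of_mem hω.2,
          Set.indicator_of_notMem (Set.disjoint_right.1 (hdisj i) hω.2), zero_add]
      · refine le_of_eq ((setLIntegral_congr_fun (g := fun _ => 1)
          ((hA'.diff hE₁').diff hE₂') fun ω hω => ?_).trans (by simp))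
        simp [hG, hω.1.2, hω.2]
    rw [one_mul, ← lintegral_inter_add_sdiff (G i) A hE₁', ← measure_inter_add_sdiff A hE₁']
    exact add_le_add b₁ b₂
  have hint := lintegral_prod_le_pow 𝓕 hGm hstep t
  rw [one_pow, one_mul, measure_univ] at hint
  set R := (s₁ ^ 2 * (m₁ * v₁) + s₂ ^ 2 * (m₂ * v₂)) / 2 with hR
  have hZm : Measurable fun ω => ∏ i ∈ Finset.range t, G i ω :=
    Finset.measurable_fun_prod _ fun i _ => (hGm i).mono (𝓕.le _) le_rfl
  have hpos : 0 < Real.exp (K - R) := Real.exp_pos _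
  have hsub : {ω | m₁ ≤ hitCount Y c ξ X Yc x₁ y m₁ t ω ∧
      m₂ ≤ hitCount Y c ξ X Yc x₂ y m₂ t ω ∧
      K ≤ s₁ * ∑ i ∈ frozen Y c ξ X Yc x₁ y m₁ t ω, ε i ω +
        s₂ * ∑ i ∈ frozen Y c ξ X Yc x₂ y m₂ t ω, ε i ω} ⊆
      {ω | ENNReal.ofReal (Real.exp (K - R)) ≤ ∏ i ∈ Finset.range t, G i ω} := by
    rintro ω ⟨h₁, h₂, hK⟩
    have hsum : ∀ (x : χ) (m : ℕ) (g : ℕ → Ω → ℝ),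
        ∑ i ∈ Finset.range t, (acceptEvent Y c ξ X Yc x y m i).indicator (g i) ω =
          ∑ i ∈ frozen Y c ξ X Yc x y m t ω, g i ω := by
      classical
      intro x m g
      simp only [Set.indicator_apply]
      rw [← Finset.sum_filter]
      refine Finset.sum_congr ?_ fun _ _ => rfl
      ext i
      rw [Finset.mem_filter, Finset.mem_range, mem_frozen]
    have hc₁ : (frozen Y c ξ X Yc x₁ y m₁ t ω).card = m₁ := (mSet_activationStage h₁).2
    have hc₂ : (frozen Y c ξ X Yc x₂ y m₂ t ω).card = m₂ := (mSet_activationStage h₂).2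
    simp only [Set.mem_ofPred_eq, hG]
    rw [← ENNReal.ofReal_prod_of_nonneg fun i _ => (Real.exp_pos _).le, ← Real.exp_sum]
    refine ENNReal.ofReal_le_ofReal (Real.exp_le_exp.2 ?_)
    rw [Finset.sum_add_distrib, hsum, hsum]
    simp only [hg₁, hg₂, Finset.sum_sub_distrib, ← Finset.mul_sum, Finset.sum_const, hc₁, hc₂,
      nsmul_eq_mul]
    linarith
  have hM := (mul_meas_ge_le_lintegral (μ := μ) hZm (ENNReal.ofReal (Real.exp (K - R)))).trans hint
  calc _ ≤ μ {ω | ENNReal.ofReal (Real.exp (K - R)) ≤ ∏ i ∈ Finset.range t, G i ω} :=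
        measure_mono hsub
    _ ≤ (ENNReal.ofReal (Real.exp (K - R)))⁻¹ := by
        rwa [ENNReal.le_inv_iff_mul_le, mul_comm]
    _ = _ := by
        rw [← ENNReal.ofReal_inv_of_pos hpos, ← Real.exp_neg, neg_sub]

/-- A deviation `δ` between the average errors of two decisions is as unlikely as for independent
samples of size `m` with variances `v₁` and `v₂`, if both levels are at least `m`. -/
theorem IsSamplingRun.measure_average_error_le [IsProbabilityMeasure μ]
    (hrun : IsSamplingRun Y σ μ 𝓕 X Yc ε a) (hσ : ∀ x, ContinuousOn (σ x) (interior Y))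
    {x₁ x₂ : χ} (hx : x₁ ≠ x₂) {y : Ctx d} {m m₁ m₂ : ℕ} (hm : 1 ≤ m) (hm₁ : m ≤ m₁)
    (hm₂ : m ≤ m₂) {v₁ v₂ : ℝ} (hv₁0 : 0 < v₁) (hv₂0 : 0 < v₂)
    (hv₁ : ∀ z ∈ contextBall Y c ξ y m₁, σ x₁ z ^ 2 ≤ v₁)
    (hv₂ : ∀ z ∈ contextBall Y c ξ y m₂, σ x₂ z ^ 2 ≤ v₂) {δ : ℝ} (hδ : 0 ≤ δ) (t : ℕ) :
    μ {ω | m₁ ≤ hitCount Y c ξ X Yc x₁ y m₁ t ω ∧ m₂ ≤ hitCount Y c ξ X Yc x₂ y m₂ t ω ∧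
      δ ≤ (∑ i ∈ frozen Y c ξ X Yc x₁ y m₁ t ω, ε i ω) / m₁ -
        (∑ i ∈ frozen Y c ξ X Yc x₂ y m₂ t ω, ε i ω) / m₂} ≤
      ENNReal.ofReal (Real.exp (-(m * (δ ^ 2 / (2 * (v₁ + v₂)))))) := by
  have hm0 : (0 : ℝ) < m := by exact_mod_cast hm
  have hmm₁ : (m : ℝ) ≤ m₁ := by exact_mod_cast hm₁
  have hmm₂ : (m : ℝ) ≤ m₂ := by exact_mod_cast hm₂
  have h₁ : (0 : ℝ) < m₁ := hm0.trans_le hmm₁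
  have h₂ : (0 : ℝ) < m₂ := hm0.trans_le hmm₂
  -- the minimizer of the exponent `s ^ 2 * (v₁ + v₂) / (2 * m) - s * δ`
  set s : ℝ := m * δ / (v₁ + v₂) with hs
  have hs0 : 0 ≤ s := by positivity
  refine (measure_mono ?_).trans ((hrun.measure_error_le hσ hx hv₁ hv₂ (s / m₁) (-(s / m₂))
    (s * δ) t).trans (ENNReal.ofReal_le_ofReal (Real.exp_le_exp.2 ?_)))
  · rintro ω ⟨a₁, a₂, a₃⟩
    refine ⟨a₁, a₂, (mul_le_mul_of_nonneg_left a₃ hs0).trans (le_of_eq ?_)⟩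
    ring
  · have e : ((s / m₁) ^ 2 * (m₁ * v₁) + (-(s / m₂)) ^ 2 * (m₂ * v₂)) / 2 =
        s ^ 2 / 2 * (v₁ / m₁ + v₂ / m₂) := by
      field_simp
    have i : v₁ / m₁ + v₂ / m₂ ≤ (v₁ + v₂) / m := by
      rw [add_div]
      gcongr
    have e' : s ^ 2 / 2 * ((v₁ + v₂) / m) - s * δ = -(m * (δ ^ 2 / (2 * (v₁ + v₂)))) := by
      rw [hs]
      field_simp
      ring
    rw [e, ← e']
    gcongr

theorem volume_ball_radius (hd : 1 ≤ d) (hc : 0 < c) (y : Ctx d) (m : ℕ) :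
    volume (Metric.ball y (radius d c ξ m)) =
      ENNReal.ofReal (volConst d c * (m : ℝ) ^ (-ξ)) := by
  have : Nonempty (Fin d) := ⟨⟨0, hd⟩⟩
  have hd0 : (d : ℝ) ≠ 0 := by exact_mod_cast (by omega : d ≠ 0)
  have hr : 0 ≤ radius d c ξ m := by unfold radius; positivity
  rw [EuclideanSpace.volume_ball, Fintype.card_fin, ← ENNReal.ofReal_pow hr,
    ← ENNReal.ofReal_mul (by positivity)]
  congr 1
  have h1 : radius d c ξ m ^ d = c ^ d * (m : ℝ) ^ (-ξ) := by
    rw [radius, mul_pow, ← Real.rpow_natCast ((m : ℝ) ^ _), ← Real.rpow_mul (Nat.cast_nonneg m),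
      div_mul_cancel₀ _ hd0]
  have h2 : √Real.pi ^ d = Real.pi ^ ((d : ℝ) / 2) := by
    rw [Real.sqrt_eq_rpow, ← Real.rpow_natCast, ← Real.rpow_mul Real.pi_pos.le]
    congr 1
    ring
  rw [h1, h2, volConst]
  ring

/-- Chernoff's bound for the event that the `m`-set is not activated at stage `t`. -/
theorem IsSamplingRun.measure_hitCount_lt_le [IsProbabilityMeasure μ] (hd : 1 ≤ d) (hc : 0 < c)
    (hrun : IsSamplingRun Y σ μ 𝓕 X Yc ε a) {lamL : ℝ} (hlam : 0 < lamL)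
    (ha : ∀ t ω x, ∀ y ∈ interior Y, lamL < a t ω x y) (x : χ) {y : Ctx d} {m : ℕ}
    (hball : Metric.ball y (radius d c ξ m) ⊆ interior Y) {θ : ℝ} (hθ : 0 ≤ θ) (t : ℕ) :
    μ {ω | hitCount Y c ξ X Yc x y m t ω < m} ≤ ENNReal.ofReal (Real.exp
      (θ * m - t * (volConst d c * lamL * (m : ℝ) ^ (-ξ) * (1 - Real.exp (-θ))))) := by
  set q : ℝ := volConst d c * lamL * (m : ℝ) ^ (-ξ) with hq
  set V := contextBall Y c ξ y m with hV
  have hVball : V = Metric.ball y (radius d c ξ m) := by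
    ext z
    simp only [hV, contextBall, Set.mem_ofPred_eq, mem_ball_iff_norm]
    exact ⟨fun h => h.1, fun h => ⟨h, hball (mem_ball_iff_norm.2 h)⟩⟩
  set E := hitEvent X Yc x V with hE
  have hEm := fun i => hrun.measurableSet_hitEvent x
    (measurableSet_contextBall (Y := Y) (c := c) (ξ := ξ) (y := y) (m := m)) i
  set G : ℕ → Ω → ℝ≥0∞ := fun i ω =>
    ENNReal.ofReal (Real.exp ((E i).indicator (fun _ => -θ) ω)) with hG
  have hGm : ∀ i, Measurable[𝓕 (i + 1)] (G i) := fun i => by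
    have h₁ : Measurable[𝓕 (i + 1)] ((E i).indicator fun _ => -θ) :=
      Measurable.indicator measurable_const (hEm i)
    exact (Real.measurable_exp.comp h₁).ennreal_ofReal
  set r := Real.exp (-(q * (1 - Real.exp (-θ)))) with hr
  have hθ1 : Real.exp (-θ) ≤ 1 := Real.exp_le_one_iff.2 (by linarith)
  have hq0 : 0 ≤ q := by unfold q volConst; positivity
  have hstep : ∀ i A, MeasurableSet[𝓕 i] A → ∫⁻ ω in A, G i ω ∂μ ≤ ENNReal.ofReal r * μ A := by
    intro i A hA
    have hA' := 𝓕.le i A hA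
    have hE' : MeasurableSet (E i) := 𝓕.le _ _ (hEm i)
    have hlow := hrun.le_measure_hitEvent ha x measurableSet_contextBall
      (fun z hz => hz.2 : V ⊆ interior Y) i hA
    rw [← hV, ← hE, hVball, volume_ball_radius hd hc, ← ENNReal.ofReal_mul hlam.le,
      show lamL * (volConst d c * (m : ℝ) ^ (-ξ)) = q by rw [hq]; ring] at hlow
    have b₁ : ∫⁻ ω in A ∩ E i, G i ω ∂μ = ENNReal.ofReal (Real.exp (-θ)) * μ (A ∩ E i) := by
      rw [← setLIntegral_const]
      refine setLIntegral_congr_fun (hA'.inter hE') fun ω hω => ?_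
      simp only [hG]
      rw [Set.indicator_of_mem hω.2]
    have b₂ : ∫⁻ ω in A \ E i, G i ω ∂μ = μ (A \ E i) := by
      refine ((setLIntegral_congr_fun (g := fun _ => 1) (hA'.diff hE') fun ω hω => ?_).trans
        (by simp))
      simp [hG, hω.2]
    rw [← lintegral_inter_add_sdiff (G i) A hE', b₁, b₂]
    have hadd := measureReal_inter_add_sdiff (μ := μ) (s := A) hE'
    rw [← ofReal_measureReal (μ := μ) (s := A), ← ENNReal.ofReal_mul (by positivity),
      ← ofReal_measureReal (μ := μ) (s := A ∩ E i), ENNReal.ofReal_le_ofReal_iff (by positivity)]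
      at hlow
    rw [← ofReal_measureReal (μ := μ) (s := A), ← ofReal_measureReal (μ := μ) (s := A ∩ E i),
      ← ofReal_measureReal (μ := μ) (s := A \ E i), ← ENNReal.ofReal_mul (by positivity),
      ← ENNReal.ofReal_mul (by positivity), ← ENNReal.ofReal_add (by positivity) (by positivity)]
    refine ENNReal.ofReal_le_ofReal ?_
    have hr1 : 1 - q * (1 - Real.exp (-θ)) ≤ r := by
      have := Real.add_one_le_exp (-(q * (1 - Real.exp (-θ))))
      linarith
    have h1 := mul_le_mul_of_nonneg_right hr1 (measureReal_nonneg (μ := μ) (s := A))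
    have h2 : q * μ.real A * (1 - Real.exp (-θ)) ≤ μ.real (A ∩ E i) * (1 - Real.exp (-θ)) :=
      mul_le_mul_of_nonneg_right hlow (by linarith)
    linarith
  have hint := lintegral_prod_le_pow 𝓕 hGm hstep t
  rw [measure_univ, mul_one] at hint
  have hZm : Measurable fun ω => ∏ i ∈ Finset.range t, G i ω :=
    Finset.measurable_fun_prod _ fun i _ => (hGm i).mono (𝓕.le _) le_rfl
  have hpos : 0 < Real.exp (-(θ * m)) := Real.exp_pos _
  have hsub : {ω | hitCount Y c ξ X Yc x y m t ω < m} ⊆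
      {ω | ENNReal.ofReal (Real.exp (-(θ * m))) ≤ ∏ i ∈ Finset.range t, G i ω} := by
    intro ω hω
    simp only [Set.mem_ofPred_eq, hG]
    rw [← ENNReal.ofReal_prod_of_nonneg fun i _ => (Real.exp_pos _).le, ← Real.exp_sum]
    refine ENNReal.ofReal_le_ofReal (Real.exp_le_exp.2 ?_)
    have e : ∑ i ∈ Finset.range t, (E i).indicator (fun _ => -θ) ω =
        -θ * hitCount Y c ξ X Yc x y m t ω := by
      rw [hitCount_eq_sum, Nat.cast_sum, Finset.mul_sum]
      refine Finset.sum_congr rfl fun i _ => ?_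
      by_cases h : ω ∈ hitEvent X Yc x (contextBall Y c ξ y m) i <;> simp [hE, hV, h]
    rw [e]
    have : (hitCount Y c ξ X Yc x y m t ω : ℝ) ≤ m := by
      exact_mod_cast (hω : hitCount Y c ξ X Yc x y m t ω < m).le
    nlinarith
  have hM := (mul_meas_ge_le_lintegral (μ := μ) hZm
    (ENNReal.ofReal (Real.exp (-(θ * m))))).trans hint
  calc _ ≤ μ {ω | ENNReal.ofReal (Real.exp (-(θ * m))) ≤ ∏ i ∈ Finset.range t, G i ω} :=
        measure_mono hsub
    _ ≤ ENNReal.ofReal r ^ t * (ENNReal.ofReal (Real.exp (-(θ * m))))⁻¹ := by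
        rw [← div_eq_mul_inv, ENNReal.le_div_iff_mul_le (by simp [hpos]) (by simp), mul_comm]
        exact hM
    _ = _ := by
        rw [← ENNReal.ofReal_inv_of_pos hpos, ← Real.exp_neg, neg_neg,
          ← ENNReal.ofReal_pow (by positivity), ← ENNReal.ofReal_mul (by positivity), hr,
          ← Real.exp_nat_mul, ← Real.exp_add]
        congr 2
        ring

end Sampling

/-! ### The rate constant -/

section Rate

/-- Existence of the value of `W₋₁` at `-exp (-z - 1)`, in the form `u - 1 - log u = z` for
`u = -W₋₁(-exp (-z - 1))`. -/
theorem lambertWm1_spec {z : ℝ} (hz : 0 ≤ z) :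
    1 ≤ -lambertWm1 (-Real.exp (-z - 1)) ∧
      -lambertWm1 (-Real.exp (-z - 1)) - 1 - Real.log (-lambertWm1 (-Real.exp (-z - 1))) = z := by
  have hex : ∃ w : ℝ, w ≤ -1 ∧ w * Real.exp w = -Real.exp (-z - 1) := by
    have hcont : ContinuousOn (fun u : ℝ => u - Real.log u) (Set.Icc 1 (2 * (1 + z))) :=
      continuousOn_id.sub (Real.continuousOn_log.mono fun u hu => by
        simp only [Set.mem_compl_iff, Set.mem_singleton_iff]
        linarith [hu.1])
    have hlog : Real.log (2 * (1 + z)) ≤ 1 + z := by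
      rw [Real.log_mul two_ne_zero (by linarith)]
      have := Real.log_le_sub_one_of_pos (show 0 < 1 + z by linarith)
      linarith [Real.log_two_lt_d9]
    obtain ⟨u, hu, he⟩ := intermediate_value_Icc (by linarith) hcont
      (show 1 + z ∈ Set.Icc _ _ from ⟨by simp; linarith, by linarith⟩)
    refine ⟨-u, by linarith [hu.1], ?_⟩
    have hu0 : 0 < u := by linarith [hu.1]
    have : -z - 1 = Real.log u + -u := by
      simp only at he
      linarith
    rw [this, Real.exp_add, Real.exp_log hu0, neg_mul]
  have hW : lambertWm1 (-Real.exp (-z - 1)) = hex.choose := dif_pos hex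
  obtain ⟨h1, h2⟩ := hex.choose_spec
  rw [← hW] at h1 h2
  set w := lambertWm1 (-Real.exp (-z - 1))
  refine ⟨by linarith, ?_⟩
  have h3 := congrArg Real.log (show -w * Real.exp w = Real.exp (-z - 1) by linarith)
  rw [Real.log_mul (by linarith) (Real.exp_pos _).ne', Real.log_exp, Real.log_exp] at h3
  linarith

/-- The rate is monotone in the signal-to-noise ratio `z = u - 1 - log u`: for `u ≤ u₀` this is
plain, and for `u₀ ≤ u` because `z / u` is nondecreasing in `u ≥ 1`. -/
theorem rate_mono {p z₀ z u₀ u : ℝ} (hp0 : 0 ≤ p) (hp1 : p ≤ 1) (hz₀ : 0 ≤ z₀) (hz : z₀ ≤ z)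
    (hu₀ : 1 ≤ u₀) (hu : 1 ≤ u) (h₀ : u₀ - 1 - Real.log u₀ = z₀) (h : u - 1 - Real.log u = z) :
    z₀ * u₀ ^ (-p) ≤ z * u ^ (-p) := by
  have hu₀' : 0 < u₀ := by linarith
  have hu' : 0 < u := by linarith
  rcases le_total u u₀ with hle | hle
  · exact mul_le_mul hz (Real.rpow_le_rpow_of_nonpos hu' hle (by linarith)) (by positivity)
      (hz₀.trans hz)
  · have hdiv : z₀ / u₀ ≤ z / u := by
      have hl := Real.log_le_sub_one_of_pos (div_pos hu' hu₀')
      rw [Real.log_div hu'.ne' hu₀'.ne', le_sub_iff_add_le, le_div_iff₀ hu₀'] at hl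
      rw [div_le_div_iff₀ hu₀' hu', ← h₀, ← h]
      nlinarith [mul_nonneg (Real.log_nonneg hu₀) (sub_nonneg.2 hle)]
    have e : ∀ w : ℝ, 0 < w → ∀ s : ℝ, s * w ^ (-p) = s / w * w ^ (1 - p) := fun w hw s => by
      rw [sub_eq_add_neg, Real.rpow_add hw, Real.rpow_one]
      field_simp
    rw [e _ hu₀', e _ hu']
    exact mul_le_mul hdiv (Real.rpow_le_rpow hu₀'.le hle (by linarith)) (by positivity)
      (div_nonneg (hz₀.trans hz) hu'.le)

theorem volConst_pos (d : ℕ) {c : ℝ} (hc : 0 < c) : 0 < volConst d c := by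
  unfold volConst
  have := Real.Gamma_pos_of_pos (show 0 < (d : ℝ) / 2 + 1 by positivity)
  positivity

variable {χ : Type*} [Finite χ] {d : ℕ} {f σ : χ → Ctx d → ℝ} {K : Set (Ctx d)}

theorem isOptimal_xStar [Nonempty χ] (f : χ → Ctx d → ℝ) (y : Ctx d) :
    IsOptimal (fun x => f x y) (xStar f y) :=
  (exists_isOptimal fun x => f x y).choose_spec

theorem zeta_le [Nonempty χ] {y : Ctx d} {x : χ} (hx : x ≠ xStar f y) : zeta f σ y ≤
    (f x y - f (xStar f y) y) ^ 2 / (2 * (σ (xStar f y) y ^ 2 + σ x y ^ 2)) :=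
  ciInf_le (Set.finite_range _).bddBelow (⟨x, hx⟩ : {x : χ // x ≠ xStar f y})

theorem exists_zeta_eq [Nontrivial χ] (f σ : χ → Ctx d → ℝ) (y : Ctx d) :
    ∃ x, x ≠ xStar f y ∧ zeta f σ y =
      (f x y - f (xStar f y) y) ^ 2 / (2 * (σ (xStar f y) y ^ 2 + σ x y ^ 2)) := by
  obtain ⟨x₀, hx₀⟩ := exists_ne (xStar f y)
  have : Nonempty {x : χ // x ≠ xStar f y} := ⟨⟨x₀, hx₀⟩⟩
  obtain ⟨x, hx⟩ := exists_eq_ciInf_of_finite (f := fun x : {x : χ // x ≠ xStar f y} =>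
    (f x y - f (xStar f y) y) ^ 2 / (2 * (σ (xStar f y) y ^ 2 + σ x y ^ 2)))
  exact ⟨x, x.2, hx.symm⟩

theorem zeta_pos [Nontrivial χ] {y : Ctx d} (hσ : ∀ x, 0 < σ x y)
    (hlt : ∀ x, x ≠ xStar f y → f (xStar f y) y < f x y) : 0 < zeta f σ y := by
  obtain ⟨x, hx, e⟩ := exists_zeta_eq f σ y
  rw [e]
  have h1 := sub_pos.2 (hlt x hx)
  have h2 := hσ x
  positivity

/-- The optimal decision is unique and hence locally constant on `K`, so `ζ` attains its minimum
there. -/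
theorem exists_zeta_le [Nontrivial χ] (hK : IsCompact K) (hne : K.Nonempty)
    (hf : ∀ x, ContinuousOn (f x) K) (hσ : ∀ x, ContinuousOn (σ x) K)
    (hσ0 : ∀ x, ∀ y ∈ K, 0 < σ x y)
    (hlt : ∀ y ∈ K, ∀ x, x ≠ xStar f y → f (xStar f y) y < f x y) :
    ∃ y₀ ∈ K, ∀ y ∈ K, zeta f σ y₀ ≤ zeta f σ y := by
  have hstar : ∀ y ∈ K, ∀ x, IsOptimal (fun x => f x y) x → x = xStar f y := fun y hy x hx => by
    by_contra hne
    exact absurd (hx (xStar f y)) (not_le.2 (hlt y hy x hne))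
  set Q : χ × χ → Ctx d → ℝ := fun p y =>
    (f p.2 y - f p.1 y) ^ 2 / (2 * (σ p.1 y ^ 2 + σ p.2 y ^ 2)) with hQ
  set S : χ × χ → Set (Ctx d) := fun p => {y ∈ K | IsOptimal (fun x => f x y) p.1 ∧ p.2 ≠ p.1}
    with hS
  have hScomp : ∀ p, IsCompact (S p) := fun p => by
    by_cases hp : p.2 = p.1
    · simp [hS, hp]
    · have : S p = ⋂ x, {y ∈ K | f p.1 y ≤ f x y} := by
        ext y
        simp only [hS, IsOptimal, Set.mem_ofPred_eq, Set.mem_iInter]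
        exact ⟨fun h x => ⟨h.1, h.2.1 x⟩, fun h => ⟨(h p.1).1, fun x => (h x).2, hp⟩⟩
      rw [this]
      refine hK.of_isClosed_subset (isClosed_iInter fun x =>
        hK.isClosed.isClosed_le (hf _) (hf x)) fun y hy => (Set.mem_iInter.1 hy p.1).1
  have hQcont : ∀ p, ContinuousOn (Q p) (S p) := fun p => by
    have hsub : S p ⊆ K := fun y hy => hy.1
    have h1 := (hf p.1).mono hsub
    have h2 := (hf p.2).mono hsub
    have h3 := (hσ p.1).mono hsub
    have h4 := (hσ p.2).mono hsub
    refine ContinuousOn.div (by fun_prop) (by fun_prop) fun y hy => ?_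
    have := hσ0 p.1 y hy.1
    positivity
  have hV : IsCompact (⋃ p, Q p '' S p) :=
    isCompact_iUnion fun p => (hScomp p).image_of_continuousOn (hQcont p)
  have hmem : ∀ y ∈ K, zeta f σ y ∈ ⋃ p, Q p '' S p := fun y hy => by
    obtain ⟨x, hx, e⟩ := exists_zeta_eq f σ y
    exact Set.mem_iUnion.2 ⟨(xStar f y, x), y, ⟨hy, isOptimal_xStar f y, hx⟩, e.symm⟩
  obtain ⟨v, hv, hleast⟩ := hV.exists_isLeast ⟨_, hmem _ hne.some_mem⟩
  obtain ⟨p, y₀, hy₀, rfl⟩ := Set.mem_iUnion.1 hv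
  refine ⟨y₀, hy₀.1, fun y hy => le_trans ?_ (hleast (hmem y hy))⟩
  have e := hstar y₀ hy₀.1 p.1 hy₀.2.1
  have := zeta_le (f := f) (σ := σ) (y := y₀) (x := p.2) (e ▸ hy₀.2.2)
  rwa [← e] at this

theorem exists_le_of_isCompact (hK : IsCompact K) (hσ : ∀ x, ContinuousOn (σ x) K)
    (hσ0 : ∀ x, ∀ y ∈ K, 0 < σ x y) : ∃ s > 0, ∀ x, ∀ y ∈ K, s ≤ σ x y := by
  rcases isEmpty_or_nonempty χ with _ | _
  · exact ⟨1, one_pos, fun x => isEmptyElim x⟩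
  rcases K.eq_empty_or_nonempty with rfl | hne
  · exact ⟨1, one_pos, by simp⟩
  have hV : IsCompact (⋃ x, σ x '' K) :=
    isCompact_iUnion fun x => hK.image_of_continuousOn (hσ x)
  obtain ⟨v, hv, hleast⟩ := hV.exists_isLeast
    ⟨_, Set.mem_iUnion.2 ⟨Classical.arbitrary χ, _, hne.some_mem, rfl⟩⟩
  obtain ⟨x, y, hy, rfl⟩ := Set.mem_iUnion.1 hv
  exact ⟨_, hσ0 x y hy, fun x' y' hy' => hleast (Set.mem_iUnion.2 ⟨x', y', hy', rfl⟩)⟩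

theorem rateHSub_eq [Nonempty χ] {c ξ lamL : ℝ} (hc : 0 < c) (hξ : 0 < ξ) (hlam : 0 < lamL)
    {y₀ : Ctx d} (hy₀ : y₀ ∈ K) (hpos : 0 < zeta f σ y₀)
    (hmin : ∀ y ∈ K, zeta f σ y₀ ≤ zeta f σ y) :
    rateHSub c ξ lamL f σ K = (rateH c ξ lamL f σ y₀ : EReal) := by
  refine le_antisymm (iInf₂_le y₀ hy₀) (le_iInf₂ fun y hy => EReal.coe_le_coe_iff.2 ?_)
  have hp1 : 1 / (1 + ξ) ≤ 1 := by
    rw [div_le_one (by linarith)]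
    linarith
  have h0 := lambertWm1_spec hpos.le
  have h1 := lambertWm1_spec (hpos.le.trans (hmin y hy))
  have hm := rate_mono (by positivity : 0 ≤ 1 / (1 + ξ)) hp1 hpos.le (hmin y hy)
    h0.1 h1.1 h0.2 h1.2
  have := volConst_pos d hc
  rw [rateH, rateH, mul_assoc, mul_assoc]
  exact mul_le_mul_of_nonneg_left hm (by positivity)

end Rate

/-! ### The probability of a wrong decision and its asymptotics -/

section Error

variable {χ : Type*} [Fintype χ] [Nontrivial χ] [MeasurableSpace χ] [MeasurableSingletonClass χ]
  {d : ℕ} {Y : Set (Ctx d)} {f σ : χ → Ctx d → ℝ} {Ω : Type*} [mΩ : MeasurableSpace Ω]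
  {μ : Measure Ω} {𝓕 : Filtration ℕ mΩ} {X : ℕ → Ω → χ} {Yc : ℕ → Ω → Ctx d} {ε : ℕ → Ω → ℝ}
  {a : ℕ → Ω → χ → Ctx d → ℝ} {c ξ : ℝ} {L₁ L₂ : ℝ≥0}

/-- Probability of a wrong decision in context `y` at stage `t`. Either some `m`-set is not yet
activated, or the levels of the estimates of `x*(y)` and of a wrong decision `x` are two numbers
between `m` and `t`, and the averages of the errors at these two levels differ by almost the gap
between `f x y` and the optimum. The parameter `η` is the relative loss caused by the variation of
`f` and `σ` over the neighborhoods. -/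
theorem IsSamplingRun.measure_ne_xStar_le [IsProbabilityMeasure μ] (hd : 1 ≤ d) (hc : 0 < c)
    (hξ : 0 < ξ) (hrun : IsSamplingRun Y σ μ 𝓕 X Yc ε a) {lamL : ℝ} (hlam : 0 < lamL)
    (ha : ∀ t ω x, ∀ y ∈ interior Y, lamL < a t ω x y)
    (hf : ∀ x, LipschitzOnWith L₁ (f x) Y) (hσ : ∀ x, LipschitzOnWith L₂ (σ x) Y)
    (hσ0 : ∀ x, ∀ y ∈ Y, 0 < σ x y) {y : Ctx d} (hy : y ∈ interior Y) {m : ℕ} (hm : 1 ≤ m)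
    (hball : Metric.ball y (radius d c ξ m) ⊆ interior Y) {η : ℝ} (hη0 : 0 < η) (hη1 : η < 1)
    (hgap0 : ∀ x, x ≠ xStar f y → f (xStar f y) y < f x y)
    (hgap : ∀ x, x ≠ xStar f y →
      2 * (L₁ * radius d c ξ m) ≤ η * (f x y - f (xStar f y) y))
    (hdev : ∀ x, L₂ * radius d c ξ m ≤ η * σ x y) {θ : ℝ} (hθ : 0 ≤ θ) (t : ℕ) {xh : Ω → χ}
    (hxh : ∀ ω, IsOptimal (fun x => estimate Y c ξ f X Yc ε t x y ω) (xh ω)) :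
    μ {ω | xh ω ≠ xStar f y} ≤
      Fintype.card χ * ENNReal.ofReal (Real.exp
        (θ * m - t * (volConst d c * lamL * (m : ℝ) ^ (-ξ) * (1 - Real.exp (-θ))))) +
      Fintype.card χ * ((t + 1 : ℕ) ^ 2 * ENNReal.ofReal (Real.exp
        (-(m * (((1 - η) / (1 + η)) ^ 2 * zeta f σ y))))) := by
  classical
  have hyY := interior_subset hy
  set x₁ := xStar f y with hx₁
  set D : χ → ℕ × ℕ → Set Ω := fun x n => {ω | x₁ ≠ x ∧ m ≤ n.1 ∧ m ≤ n.2 ∧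
    n.1 ≤ hitCount Y c ξ X Yc x₁ y n.1 t ω ∧ n.2 ≤ hitCount Y c ξ X Yc x y n.2 t ω ∧
    (f x y - f x₁ y) * (1 - η) ≤ (∑ i ∈ frozen Y c ξ X Yc x₁ y n.1 t ω, ε i ω) / n.1 -
      (∑ i ∈ frozen Y c ξ X Yc x y n.2 t ω, ε i ω) / n.2} with hD
  set P := Finset.range (t + 1) ×ˢ Finset.range (t + 1) with hP
  have hsub : {ω | xh ω ≠ x₁} ⊆
      (⋃ x, {ω | hitCount Y c ξ X Yc x y m t ω < m}) ∪ ⋃ x, ⋃ n ∈ P, D x n := by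
    intro ω hω
    by_cases hact : ∃ x, hitCount Y c ξ X Yc x y m t ω < m
    · exact Or.inl (Set.mem_iUnion.2 hact)
    right
    push Not at hact
    set ψ : χ → ℕ := fun x => psiLevel Y c ξ (fun i => X i ω) (fun i => Yc i ω) x y t with hψ
    have hψm : ∀ x, m ≤ ψ x := fun x => le_psiLevel (hact x)
    have hψt : ∀ x, ψ x ∈ Finset.range (t + 1) := fun x =>
      Finset.mem_range.2 (Nat.lt_succ_of_le psiLevel_le)
    refine Set.mem_iUnion.2 ⟨xh ω, Set.mem_iUnion₂.2 ⟨(ψ x₁, ψ (xh ω)),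
      Finset.mem_product.2 ⟨hψt _, hψt _⟩, Ne.symm hω, hψm _, hψm _, psiLevel_le_card,
      psiLevel_le_card, ?_⟩⟩
    have hest : ∀ x, |estimate Y c ξ f X Yc ε t x y ω -
        (f x y + (∑ i ∈ frozen Y c ξ X Yc x y (ψ x) t ω, ε i ω) / ψ x)| ≤
          L₁ * radius d c ξ m := fun x => by
      rw [estimate, sne_eq]
      exact sum_frozenSet_bounds (hm.trans (hψm x)) (hf x) hyY (radius_anti hc hξ hm (hψm x))
        (fun i => ε i ω) psiLevel_le_card
    have h1 := abs_le.1 (hest x₁)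
    have h2 := abs_le.1 (hest (xh ω))
    have h3 : estimate Y c ξ f X Yc ε t (xh ω) y ω ≤ estimate Y c ξ f X Yc ε t x₁ y ω := hxh ω x₁
    have h4 := hgap (xh ω) hω
    simp only
    linarith [h1.1, h1.2, h2.1, h2.2]
  have hDle : ∀ x n, μ (D x n) ≤ ENNReal.ofReal (Real.exp
      (-(m * (((1 - η) / (1 + η)) ^ 2 * zeta f σ y)))) := by
    intro x n
    by_cases hn : x₁ ≠ x ∧ m ≤ n.1 ∧ m ≤ n.2
    swap
    · rw [show D x n = ∅ from Set.eq_empty_of_forall_notMem fun ω hω =>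
        hn ⟨hω.1, hω.2.1, hω.2.2.1⟩, measure_empty]
      exact zero_le
    obtain ⟨hxx, hn₁, hn₂⟩ := hn
    have hv : ∀ x' (k : ℕ), m ≤ k → ∀ z ∈ contextBall Y c ξ y k,
        σ x' z ^ 2 ≤ (σ x' y * (1 + η)) ^ 2 := by
      rintro x' k hk z ⟨hz, hzY⟩
      have h1 := (hσ x').dist_le_mul z (interior_subset hzY) y hyY
      rw [Real.dist_eq, dist_eq_norm] at h1
      have h2 : (L₂ : ℝ) * ‖z - y‖ ≤ L₂ * radius d c ξ m :=
        mul_le_mul_of_nonneg_left (hz.le.trans (radius_anti hc hξ hm hk)) L₂.2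
      have h3 := hdev x'
      exact pow_le_pow_left₀ (hσ0 x' z (interior_subset hzY)).le
        (by linarith [(abs_le.1 h1).2]) 2
    have hs₁ := hσ0 x₁ y hyY
    have hs := hσ0 x y hyY
    have hΔ := sub_pos.2 (hgap0 x hxx.symm)
    have hη : 0 < 1 - η := by linarith
    refine le_trans (measure_mono ?_)
      ((hrun.measure_average_error_le (fun x => (hσ x).continuousOn.mono interior_subset) hxx hm
        hn₁ hn₂ (by positivity) (by positivity) (hv x₁ n.1 hn₁) (hv x n.2 hn₂)
        (mul_nonneg hΔ.le hη.le) t).trans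
        (ENNReal.ofReal_le_ofReal (Real.exp_le_exp.2 (neg_le_neg ?_))))
    · rintro ω ⟨-, -, -, h₁, h₂, h₃⟩
      exact ⟨h₁, h₂, h₃⟩
    refine mul_le_mul_of_nonneg_left ?_ (Nat.cast_nonneg m)
    refine (mul_le_mul_of_nonneg_left (zeta_le (σ := σ) hxx.symm) (sq_nonneg _)).trans
      (le_of_eq ?_)
    rw [← hx₁]
    field_simp
  refine (measure_mono hsub).trans ((measure_union_le _ _).trans (add_le_add ?_ ?_))
  · refine (measure_iUnion_fintype_le _ _).trans ((Finset.sum_le_sum fun x _ =>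
      hrun.measure_hitCount_lt_le hd hc hlam ha x hball hθ t).trans (le_of_eq ?_))
    rw [Finset.sum_const, Finset.card_univ, nsmul_eq_mul]
  · refine (measure_iUnion_fintype_le _ _).trans ((Finset.sum_le_sum fun x _ =>
      (measure_biUnion_finset_le _ _).trans (Finset.sum_le_sum fun n _ => hDle x n)).trans
        (le_of_eq ?_))
    simp only [Finset.sum_const, Finset.card_univ, nsmul_eq_mul, hP, Finset.card_product,
      Finset.card_range, Nat.cast_mul, sq]

end Error

section Asymptotics

theorem tendsto_stage_rpow_atTop {p : ℝ} (hp : 0 < p) :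
    Tendsto (fun t : ℕ => (t : ℝ) ^ p) atTop atTop :=
  (tendsto_rpow_atTop hp).comp tendsto_natCast_atTop_atTop

/-- With `m = ⌈α * t ^ (1 / (1 + ξ))⌉` and `α = (K / u) ^ (1 / (1 + ξ))`, the expected number of
hits is asymptotically `u * m`, and Chernoff's exponent at the optimal `θ = log u` is
asymptotically `m * (u - 1 - log u)`. -/
theorem eventually_chernoff_exponent_le {ξ K u α c₃ : ℝ} (hξ : 0 < ξ) (hK : 0 < K) (hu : 1 ≤ u)
    (hα : α = (K / u) ^ (1 / (1 + ξ))) (hc₃ : c₃ < α * (u - 1 - Real.log u)) :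
    ∀ᶠ t : ℕ in atTop,
      Real.log u * ⌈α * (t : ℝ) ^ (1 / (1 + ξ))⌉₊ -
        t * (K * (⌈α * (t : ℝ) ^ (1 / (1 + ξ))⌉₊ : ℝ) ^ (-ξ) * (1 - Real.exp (-Real.log u))) ≤
      -(c₃ * (t : ℝ) ^ (1 / (1 + ξ))) := by
  have hu0 : 0 < u := by linarith
  have hα0 : 0 < α := hα ▸ by positivity
  have hp : 0 < 1 / (1 + ξ) := by positivity
  have hratio : Tendsto (fun t : ℕ => (⌈α * (t : ℝ) ^ (1 / (1 + ξ))⌉₊ : ℝ) /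
      (t : ℝ) ^ (1 / (1 + ξ))) atTop (𝓝 α) :=
    (tendsto_nat_ceil_mul_div_atTop hα0.le).comp (tendsto_stage_rpow_atTop hp)
  have hlim := (hratio.const_mul (Real.log u)).sub
    (((hratio.rpow_const (p := -ξ) (Or.inl hα0.ne')).const_mul K).mul_const
      (1 - Real.exp (-Real.log u)))
  have hKα : K * α ^ (-ξ) = α * u := by
    have h1 : α ^ (1 + ξ) = K / u := by
      rw [hα, ← Real.rpow_mul (by positivity), one_div_mul_cancel (by positivity), Real.rpow_one]
    rw [Real.rpow_add hα0, Real.rpow_one, eq_div_iff hu0.ne'] at h1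
    rw [Real.rpow_neg hα0.le, ← h1]
    field_simp
  have hval : Real.log u * α - K * α ^ (-ξ) * (1 - Real.exp (-Real.log u)) < -c₃ := by
    rw [hKα, Real.exp_neg, Real.exp_log hu0]
    have : α * u * (1 - u⁻¹) = α * (u - 1) := by field_simp
    linarith
  filter_upwards [hlim.eventually (gt_mem_nhds hval), eventually_ge_atTop 1] with t ht ht1
  have ht0 : (0 : ℝ) < t := by exact_mod_cast ht1
  set T := (t : ℝ) ^ (1 / (1 + ξ)) with hT
  have hT0 : 0 < T := by positivity
  have hTt : T * T ^ ξ = t := by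
    rw [← Real.rpow_one_add' hT0.le (by positivity), hT, ← Real.rpow_mul ht0.le,
      one_div_mul_cancel (by positivity), Real.rpow_one]
  have h := mul_le_mul_of_nonneg_left ht.le hT0.le
  rw [Real.div_rpow (Nat.cast_nonneg _) hT0.le, Real.rpow_neg hT0.le ξ] at h
  refine le_trans (le_of_eq ?_) (h.trans (le_of_eq (by ring)))
  rw [← hTt]
  field_simp

theorem exists_relative_loss {b c₃ : ℝ} (h : c₃ < b) :
    ∃ η : ℝ, 0 < η ∧ η < 1 ∧ c₃ < ((1 - η) / (1 + η)) ^ 2 * b := by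
  have hcont : ContinuousAt (fun η : ℝ => ((1 - η) / (1 + η)) ^ 2 * b) 0 := by
    fun_prop (disch := norm_num)
  have h0 : ∀ᶠ η in 𝓝 (0 : ℝ), c₃ < ((1 - η) / (1 + η)) ^ 2 * b :=
    hcont.eventually (lt_mem_nhds (by simpa using h))
  obtain ⟨η, h3, h1, h2⟩ := ((h0.filter_mono nhdsWithin_le_nhds).and
    (Ioo_mem_nhdsGT (zero_lt_one (α := ℝ)))).exists
  exact ⟨η, h1, h2, h3⟩

/-- A gap between two exponents absorbs the polynomial factor of a union bound. -/
theorem eventually_mul_sq_mul_exp_le {p : ℝ} (hp : 0 < p) {c₂ c₃ : ℝ} (h : c₂ < c₃) (B : ℝ) :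
    ∀ᶠ t : ℕ in atTop, B * (1 + ((t + 1 : ℕ) : ℝ) ^ 2) * Real.exp (-(c₃ * (t : ℝ) ^ p)) ≤
      Real.exp (-(c₂ * (t : ℝ) ^ p)) := by
  have hlim := ((tendsto_rpow_mul_exp_neg_mul_atTop_nhds_zero (2 / p) (c₃ - c₂)
    (sub_pos.2 h)).comp (tendsto_stage_rpow_atTop hp)).const_mul (5 * |B|)
  rw [mul_zero] at hlim
  filter_upwards [hlim.eventually (gt_mem_nhds zero_lt_one), eventually_ge_atTop 1] with t ht ht1
  have ht1' : (1 : ℝ) ≤ t := by exact_mod_cast ht1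
  have hpow : ((t : ℝ) ^ p) ^ (2 / p) = (t : ℝ) ^ 2 := by
    rw [← Real.rpow_mul (by linarith), mul_div_cancel₀ _ hp.ne', Real.rpow_two]
  simp only [Function.comp_apply, hpow] at ht
  set T := (t : ℝ) ^ p
  have hexp : Real.exp (-(c₃ * T)) = Real.exp (-(c₃ - c₂) * T) * Real.exp (-(c₂ * T)) := by
    rw [← Real.exp_add]
    congr 1
    ring
  have hpoly : B * (1 + ((t + 1 : ℕ) : ℝ) ^ 2) ≤ 5 * |B| * (t : ℝ) ^ 2 := by
    refine (mul_le_mul_of_nonneg_right (le_abs_self B) (by positivity)).trans ?_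
    have : 1 + ((t + 1 : ℕ) : ℝ) ^ 2 ≤ 5 * (t : ℝ) ^ 2 := by
      push_cast
      nlinarith
    nlinarith [mul_le_mul_of_nonneg_left this (abs_nonneg B)]
  rw [hexp, ← mul_assoc]
  refine mul_le_of_le_one_left (Real.exp_pos _).le ?_
  refine (mul_le_mul_of_nonneg_right hpoly (Real.exp_pos _).le).trans ?_
  rw [mul_assoc]
  exact ht.le

theorem tendsto_radius {d : ℕ} (hd : 1 ≤ d) {c ξ : ℝ} (hξ : 0 < ξ) :
    Tendsto (radius d c ξ) atTop (𝓝 0) := by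
  have hd0 : (0 : ℝ) < d := by exact_mod_cast hd
  have := ((tendsto_rpow_neg_atTop (div_pos hξ hd0)).comp
    tendsto_natCast_atTop_atTop).const_mul c
  rw [mul_zero] at this
  refine this.congr fun m => ?_
  rw [radius, neg_div, Function.comp_apply]

/-- An eventual bound `exp (-c₂ * t ^ p)` for every `c₂` below `H` bounds the exponential rate
by `H` from below. -/
theorem le_liminf_neg_log {p : ℝ} {H : EReal} {ℓ : ℕ → ℝ≥0∞}
    (h : ∀ c₂ : ℝ, (c₂ : EReal) < H → ∀ᶠ t : ℕ in atTop,
      ℓ t ≤ ENNReal.ofReal (Real.exp (-(c₂ * (t : ℝ) ^ p)))) :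
    H ≤ liminf (fun t : ℕ => ((-(1 / (t : ℝ) ^ p) : ℝ) : EReal) * ENNReal.log (ℓ t)) atTop := by
  refine EReal.ge_of_forall_gt_iff_ge.1 fun c₂ hc₂ => ?_
  refine le_liminf_of_le (by isBoundedDefault) ?_
  filter_upwards [h c₂ hc₂, eventually_ge_atTop 1] with t ht ht1
  have ht0 : (0 : ℝ) < t := by exact_mod_cast ht1
  have hT : 0 < (t : ℝ) ^ p := by positivity
  have hlog := ENNReal.log_monotone ht
  rw [ENNReal.log_ofReal_of_pos (Real.exp_pos _), Real.log_exp] at hlog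
  have hneg : ((-(1 / (t : ℝ) ^ p) : ℝ) : EReal) ≤ 0 := by
    rw [EReal.coe_nonpos, neg_nonpos]
    positivity
  rw [mul_comm]
  refine le_trans (le_of_eq ?_) (EReal.mul_le_mul_of_nonpos_right hlog hneg)
  rw [← EReal.coe_mul]
  congr 1
  field_simp

end Asymptotics

/-! ### The decay of the loss -/

theorem proposition2
    -- decisions and contexts
    {χ : Type*} [Finite χ] [Nontrivial χ] [MeasurableSpace χ] [MeasurableSingletonClass χ]
    {d : ℕ} (hd : 1 ≤ d) (Y : Set (Ctx d)) (hY : Bornology.IsBounded Y)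
    (PY : Measure (Ctx d)) [IsProbabilityMeasure PY] (hPY : ∀ᵐ y ∂PY, y ∈ Y)
    -- performance functions: uniformly bounded and Lipschitz
    (f : χ → Ctx d → ℝ) (L₁ : ℝ≥0) (hf_bdd : ∃ M : ℝ, ∀ x, ∀ y ∈ Y, |f x y| ≤ M)
    (hf_lip : ∀ x, LipschitzOnWith L₁ (f x) Y)
    -- standard deviations of the errors: positive and Lipschitz
    (σ : χ → Ctx d → ℝ) (L₂ : ℝ≥0) (hσ_pos : ∀ x, ∀ y ∈ Y, 0 < σ x y)
    (hσ_lip : ∀ x, LipschitzOnWith L₂ (σ x) Y)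
    -- the metric that measures the loss
    (ρ : ℝ → ℝ → ℝ) (hρ : IsRealMetric ρ) (hρ_meas : Measurable (Function.uncurry ρ))
    (hρ_bdd : ∀ M : ℝ, ∃ B : ℝ, ∀ u v, |u| ≤ M → |v| ≤ M → ρ u v ≤ B)
    -- parameters of the neighborhoods
    (c ξ : ℝ) (hc : 0 < c) (hξ : 0 < ξ)
    -- dynamic random sampling with density bounded below by `lamL`
    {Ω : Type*} [mΩ : MeasurableSpace Ω] (μ : Measure Ω) [IsProbabilityMeasure μ]
    (𝓕 : Filtration ℕ mΩ) (X : ℕ → Ω → χ) (Yc : ℕ → Ω → Ctx d) (ε : ℕ → Ω → ℝ)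
    (a : ℕ → Ω → χ → Ctx d → ℝ) (hrun : IsSamplingRun Y σ μ 𝓕 X Yc ε a)
    (lamL : ℝ) (hlamL : 0 < lamL) (ha : ∀ t ω x, ∀ y ∈ interior Y, lamL < a t ω x y)
    -- the inferred decision minimizes the estimates, with an arbitrary, possibly random, tie-break
    (xhat : ℕ → Ctx d → Ω → χ) (hxhat_meas : ∀ t, ∀ y ∈ interior Y, Measurable (xhat t y))
    (hxhat : ∀ t, ∀ y ∈ interior Y, ∀ ω,
      IsOptimal (fun x => estimate Y c ξ f X Yc ε t x y ω) (xhat t y ω))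
    -- a compact set of contexts without multi-optimum contexts
    (Ysub : Set (Ctx d)) (hYsub : IsCompact Ysub) (hYsubY : Ysub ⊆ interior Y)
    (hMO : Ysub ∩ multiOptimum Y f = ∅) :
    0 < rateHSub c ξ lamL f σ Ysub ∧
    rateHSub c ξ lamL f σ Ysub ≤
      liminf (fun t : ℕ => ((-(1 / (t : ℝ) ^ (1 / (1 + ξ))) : ℝ) : EReal) *
        ENNReal.log (subLoss μ PY f ρ xhat Ysub t)) atTop ∧
    ∀ c₂ : ℝ, (c₂ : EReal) < rateHSub c ξ lamL f σ Ysub →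
      ∀ᶠ t : ℕ in atTop, subLoss μ PY f ρ xhat Ysub t ≤
        ENNReal.ofReal (Real.exp (-(c₂ * (t : ℝ) ^ (1 / (1 + ξ))))) := by
  have := Fintype.ofFinite χ
  have hsubY : Ysub ⊆ Y := hYsubY.trans interior_subset
  have hgap : ∀ y ∈ Ysub, ∀ x, x ≠ xStar f y → f (xStar f y) y < f x y := by
    intro y hy x hx
    by_contra hle
    have hmem : y ∈ Ysub ∩ multiOptimum Y f := ⟨hy, hsubY hy, xStar f y, x, hx.symm,
      isOptimal_xStar f y, fun x' => (not_lt.1 hle).trans (isOptimal_xStar f y x')⟩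
    rw [hMO] at hmem
    exact hmem
  have hcf := fun x => (hf_lip x).continuousOn.mono hsubY
  have hcσ := fun x => (hσ_lip x).continuousOn.mono hsubY
  have hσK : ∀ x, ∀ y ∈ Ysub, 0 < σ x y := fun x y hy => hσ_pos x y (hsubY hy)
  rcases Ysub.eq_empty_or_nonempty with rfl | hne
  · have hall : ∀ c₂ : ℝ, ∀ᶠ t : ℕ in atTop, subLoss μ PY f ρ xhat ∅ t ≤
        ENNReal.ofReal (Real.exp (-(c₂ * (t : ℝ) ^ (1 / (1 + ξ))))) := fun c₂ =>
      Eventually.of_forall fun t => by simp [subLoss]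
    exact ⟨by simp [rateHSub], le_liminf_neg_log fun c₂ _ => hall c₂, fun c₂ _ => hall c₂⟩
  obtain ⟨y₀, hy₀, hmin⟩ := exists_zeta_le hYsub hne hcf hcσ hσK hgap
  set z := zeta f σ y₀ with hz
  have hz0 : 0 < z := zeta_pos (fun x => hσK x y₀ hy₀) (hgap y₀ hy₀)
  have hH : rateHSub c ξ lamL f σ Ysub = (rateH c ξ lamL f σ y₀ : EReal) :=
    rateHSub_eq hc hξ hlamL hy₀ hz0 hmin
  obtain ⟨hu1, hulog⟩ := lambertWm1_spec hz0.le
  set u := -lambertWm1 (-Real.exp (-z - 1)) with hu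
  have hu0 : 0 < u := by linarith
  set K := volConst d c * lamL with hK
  have hK0 : 0 < K := mul_pos (volConst_pos d hc) hlamL
  set p := 1 / (1 + ξ) with hp
  have hp0 : 0 < p := by positivity
  -- `α * t ^ p` is the level at which the two sources of error are equally likely
  set α := (K / u) ^ p with hα
  have hα0 : 0 < α := by positivity
  have hHα : rateH c ξ lamL f σ y₀ = α * z := by
    rw [rateH, ← hz, ← hu, ← hK, ← hp, hα, Real.div_rpow hK0.le hu0.le, Real.rpow_neg hu0.le]
    field_simp
  have hmain : ∀ c₂ : ℝ, (c₂ : EReal) < rateHSub c ξ lamL f σ Ysub →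
      ∀ᶠ t : ℕ in atTop, subLoss μ PY f ρ xhat Ysub t ≤
        ENNReal.ofReal (Real.exp (-(c₂ * (t : ℝ) ^ p))) := by
    intro c₂ hc₂
    rw [hH, EReal.coe_lt_coe_iff, hHα] at hc₂
    obtain ⟨c₃, hc₂₃, hc₃⟩ := exists_between hc₂
    obtain ⟨η, hη0, hη1, hη⟩ := exists_relative_loss hc₃
    obtain ⟨s, hs0, hs⟩ := exists_le_of_isCompact hYsub hcσ hσK
    obtain ⟨M, hM⟩ := hf_bdd
    obtain ⟨B, hB⟩ := hρ_bdd M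
    obtain ⟨r₀, hr₀, hball⟩ := hYsub.exists_thickening_subset_open isOpen_interior hYsubY
    -- a uniform lower bound for the gap, from those for `ζ` and `σ`
    set Δ := 2 * s * √z with hΔ
    have hΔ0 : 0 < Δ := by positivity
    have hgapΔ : ∀ y ∈ Ysub, ∀ x, x ≠ xStar f y → Δ ≤ f x y - f (xStar f y) y := by
      intro y hy x hx
      have h0 := sub_pos.2 (hgap y hy x hx)
      have h1 := hs (xStar f y) y hy
      have h2 := hs x y hy
      have h3 := (hmin y hy).trans (zeta_le (σ := σ) hx)
      have h4 := pow_le_pow_left₀ hs0.le h1 2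
      have h5 := pow_le_pow_left₀ hs0.le h2 2
      rw [le_div_iff₀ (by nlinarith [sq_pos_of_pos hs0])] at h3
      refine le_of_sq_le_sq ?_ h0.le
      rw [hΔ, mul_pow, mul_pow, Real.sq_sqrt hz0.le]
      nlinarith [mul_le_mul_of_nonneg_left (add_le_add h4 h5) hz0.le]
    set m : ℕ → ℕ := fun t => ⌈α * (t : ℝ) ^ p⌉₊ with hm
    have hmtop : Tendsto m atTop atTop :=
      tendsto_nat_ceil_atTop.comp ((tendsto_stage_rpow_atTop hp0).const_mul_atTop hα0)
    have hrad := (tendsto_radius hd hξ (c := c)).comp hmtop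
    have hev : ∀ {k e : ℝ}, 0 < e → ∀ᶠ t in atTop, k * radius d c ξ (m t) ≤ e := by
      intro k e he
      have h := hrad.const_mul k
      rw [mul_zero] at h
      exact (h.eventually (gt_mem_nhds he)).mono fun t ht => ht.le
    filter_upwards [hmtop.eventually_ge_atTop 1, hev (k := 1) hr₀,
      hev (k := 2 * L₁) (mul_pos hη0 hΔ0), hev (k := L₂) (mul_pos hη0 hs0),
      eventually_chernoff_exponent_le hξ hK0 hu1 hα (c₃ := c₃) (by rwa [hulog]),
      eventually_mul_sq_mul_exp_le hp0 hc₂₃ (max B 0 * Fintype.card χ)] with t h1 h2 h3 h4 h5 h6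
    set T := (t : ℝ) ^ p with hT
    have hT0 : 0 ≤ T := by positivity
    have hprob : ∀ y ∈ Ysub, μ {ω | xhat t y ω ≠ xStar f y} ≤ ENNReal.ofReal
        (Fintype.card χ * (1 + ((t + 1 : ℕ) : ℝ) ^ 2) * Real.exp (-(c₃ * T))) := by
      intro y hy
      have hb : Metric.ball y (radius d c ξ (m t)) ⊆ interior Y :=
        (Metric.ball_subset_ball (by linarith)).trans
          ((Metric.ball_subset_thickening hy r₀).trans hball)
      refine (hrun.measure_ne_xStar_le hd hc hξ hlamL ha hf_lip hσ_lip hσ_pos (hYsubY hy) h1 hb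
        hη0 hη1 (hgap y hy) (fun x hx => ?_) (fun x => ?_) (Real.log_nonneg hu1) t
        (hxhat t y (hYsubY hy))).trans ?_
      · have := mul_le_mul_of_nonneg_left (hgapΔ y hy x hx) hη0.le
        linarith
      · exact h4.trans (mul_le_mul_of_nonneg_left (hs x y hy) hη0.le)
      · have e1 : c₃ * T ≤ m t * (((1 - η) / (1 + η)) ^ 2 * zeta f σ y) := by
          have a1 := mul_le_mul_of_nonneg_right hη.le hT0
          have a2 : 0 ≤ ((1 - η) / (1 + η)) ^ 2 * z := by positivity
          have a3 := mul_le_mul_of_nonneg_right (Nat.le_ceil (α * T)) a2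
          have a4 := mul_le_mul_of_nonneg_left (hmin y hy) (sq_nonneg ((1 - η) / (1 + η)))
          have a5 := mul_le_mul_of_nonneg_left a4 (Nat.cast_nonneg (α := ℝ) (m t))
          linarith
        have e2 : ENNReal.ofReal
            (Fintype.card χ * (1 + ((t + 1 : ℕ) : ℝ) ^ 2) * Real.exp (-(c₃ * T))) =
            Fintype.card χ * ENNReal.ofReal (Real.exp (-(c₃ * T))) +
            Fintype.card χ * ((t + 1 : ℕ) ^ 2 * ENNReal.ofReal (Real.exp (-(c₃ * T)))) := by
          rw [mul_assoc, ENNReal.ofReal_mul (Nat.cast_nonneg _), ENNReal.ofReal_natCast,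
            ← mul_add, add_mul, one_mul, ENNReal.ofReal_add (by positivity) (by positivity),
            ENNReal.ofReal_mul (by positivity), ENNReal.ofReal_pow (Nat.cast_nonneg _),
            ENNReal.ofReal_natCast]
        rw [e2]
        gcongr
    have hcond : ∀ y ∈ Ysub, condLoss μ f ρ xhat t y ≤
        ENNReal.ofReal (Real.exp (-(c₂ * T))) := by
      intro y hy
      have hpt : ∀ ω, ENNReal.ofReal (ρ (f (xhat t y ω) y) (f (xStar f y) y)) ≤
          {ω | xhat t y ω ≠ xStar f y}.indicator (fun _ => ENNReal.ofReal (max B 0)) ω := by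
        intro ω
        by_cases h : xhat t y ω = xStar f y
        · simp [h, (hρ.eq_zero_iff _ _).2 rfl]
        · rw [Set.indicator_of_mem (show ω ∈ {ω | xhat t y ω ≠ xStar f y} from h)]
          exact ENNReal.ofReal_le_ofReal
            ((hB _ _ (hM _ _ (hsubY hy)) (hM _ _ (hsubY hy))).trans (le_max_left _ _))
      calc condLoss μ f ρ xhat t y
          ≤ ENNReal.ofReal (max B 0) * μ {ω | xhat t y ω ≠ xStar f y} :=
            (lintegral_mono hpt).trans (lintegral_indicator_const_le _ _)
        _ ≤ ENNReal.ofReal (max B 0) * ENNReal.ofReal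
            (Fintype.card χ * (1 + ((t + 1 : ℕ) : ℝ) ^ 2) * Real.exp (-(c₃ * T))) := by
            gcongr
            exact hprob y hy
        _ ≤ ENNReal.ofReal (Real.exp (-(c₂ * T))) := by
            rw [← ENNReal.ofReal_mul (le_max_right _ _)]
            exact ENNReal.ofReal_le_ofReal (le_trans (le_of_eq (by ring)) h6)
    calc subLoss μ PY f ρ xhat Ysub t
        ≤ ∫⁻ _ in Ysub, ENNReal.ofReal (Real.exp (-(c₂ * T))) ∂PY :=
          setLIntegral_mono' hYsub.measurableSet hcond
      _ ≤ ENNReal.ofReal (Real.exp (-(c₂ * T))) := by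
          rw [setLIntegral_const]
          exact mul_le_of_le_one_right' prob_le_one
  refine ⟨?_, le_liminf_neg_log hmain, hmain⟩
  rw [hH, hHα]
  exact_mod_cast mul_pos hα0 hz0
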